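/- Let $\alpha$ be an infinite set. Terms of the language of $\mathsf{CA}_\alpha$ are built from the variables $x_0,x_1,x_2,\dots$ by a binary operation $+$, a unary operation $-$, unary operations $c_i$ and constants $d_{ij}$ ($i,j\in\alpha$); put $x\cdot y:=-(-x+-y)$, $1:=x_0+-x_0$, $0:=-1$. An equation is a pair of terms, written $\tau=\sigma$, and $\mathrm{ind}(e)$ is the set of indices of operations occurring in the equation $e$. For a set $U$ and a set $V\subseteq{}^\alpha U$ of functions from $\alpha$ to $U$, the full cylindric set algebra with unit $V$ is $\langle \mathcal P(V),\cup,-,C_i,D_{ij}\rangle_{i,j\in\alpha}$, where $-$ is complement relative to $V$, $C_iX$ is the set of all $s\in V$ that agree with some $t\in X$ at all places other than $i$, and $D_{ij}=\{s\in V: s_i=s_j\}$. Let $\mathsf{RCA}_\alpha$ be the class of all algebras isomorphic to a subalgebra of a full cylindric set algebra whose unit is a union of pairwise disjoint sets of the form ${}^\alpha W$, and let $\mathrm{Eq}(\mathsf{RCA}_\alpha)$ be the set of all equations valid in all members of $\mathsf{RCA}_\alpha$. Then $\mathrm{Eq}(\mathsf{RCA}_\alpha)$ is the least set $E$ of equations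 (with respect to inclusion) such that 1. $E$ contains the cylindric algebra axioms, for all $i,j,k\in\alpha$: $(C_0)$ equations stating that $+,-$ form a Boolean algebra; $(C_1)$ $c_i0=0$; $(C_2)$ $x\le c_ix$, i.e. $x+c_ix=c_ix$; $(C_3)$ $c_i(x\cdot c_iy)=c_ix\cdot c_iy$; $(C_4)$ $c_ic_jx=c_jc_ix$; $(C_5)$ $d_{ii}=1$; $(C_6)$ $d_{ij}=c_k(d_{ik}\cdot d_{kj})$ if $k\ne i,j$; $(C_7)$ $c_i(d_{ij}\cdot x)\cdot c_i(d_{ij}\cdot -x)=0$ if $i\neq j$; 2. $E$ is closed under the five rules of equational logic: reflexivity, symmetry, transitivity, replacement (congruence for each operation), and substitution of terms for variables; 3. $E$ is closed under the inductive rule: if $e(x_1,\dots,x_n)$ is an equation whose variables are among $x_1,\dots,x_n$, if $i\in\alpha\setminus\mathrm{ind}(e)$ and $e(c_ix_1,\dots,c_ix_n)\in E$, then $e(x_1,\dots,x_n)\in E$. Moreover, $\mathrm{Eq}(\mathsf{RCA}_\alpha)$ is recursively enumerable in the following sense: for every injective $\rho:\mathbb N\to\alpha$, the set of Gödel numbers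 (in a standard numbering) of those equations $e$ in the language with index set $\mathbb N$ for which $\rho(e)\in\mathrm{Eq}(\mathsf{RCA}_\alpha)$ is recursively enumerable, where $\rho(e)$ arises from $e$ by renaming each index $n$ to $\rho(n)$. (For countable $\alpha$ one may take $\rho$ to be a bijection.) -/

import Mathlib

universe u v

namespace CylAlg

/-- Terms of the language of cylindric algebras of dimension `α`, with algebraic variables
`x₀, x₁, x₂, …` and basic operations `+`, `-`, `c_i`, `d_ij` for `i, j ∈ α`. -/
inductive Term (α : Type u) : Type u where
  | var (n : ℕ) : Term α
  | add (s t : Term α) : Term α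
  | neg (t : Term α) : Term α
  | cyl (i : α) (t : Term α) : Term α
  | diag (i j : α) : Term α

namespace Term

variable {α : Type u} {β : Type v}

/-- `s · t`, the Boolean meet defined from `+` and `-`. -/
def mul (s t : Term α) : Term α := neg (add (neg s) (neg t))

/-- The Boolean unit, defined as `x₀ + -x₀`. -/
def one : Term α := add (var 0) (neg (var 0))

/-- The Boolean zero, defined as `-1`. -/
def zero : Term α := neg one

/-- The set of indices that occur in a term. -/
def ind : Term α → Set α
  | var _ => ∅
  | add s t => ind s ∪ ind t
  | neg t => ind t
  | cyl i t => {i} ∪ ind t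
  | diag i j => {i, j}

/-- Simultaneous substitution of the terms `σ 0, σ 1, …` for the variables `x₀, x₁, …`. -/
def subst (σ : ℕ → Term α) : Term α → Term α
  | var n => σ n
  | add s t => add (subst σ s) (subst σ t)
  | neg t => neg (subst σ t)
  | cyl i t => cyl i (subst σ t)
  | diag i j => diag i j

/-- Renaming of the indices of the operations. -/
def rename (ρ : α → β) : Term α → Term β
  | var n => var n
  | add s t => add (rename ρ s) (rename ρ t)
  | neg t => neg (rename ρ t)
  | cyl i t => cyl (ρ i) (rename ρ t)
  | diag i j => diag (ρ i) (ρ j)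

/-- A standard Gödel numbering of the terms whose indices are natural numbers. -/
def code : Term ℕ → ℕ
  | var n => Nat.pair 0 n
  | add s t => Nat.pair 1 (Nat.pair (code s) (code t))
  | neg t => Nat.pair 2 (code t)
  | cyl i t => Nat.pair 3 (Nat.pair i (code t))
  | diag i j => Nat.pair 4 (Nat.pair i j)

end Term

/-- Equations `lhs = rhs` in the language of cylindric algebras of dimension `α`. -/
structure Equation (α : Type u) : Type u where
  lhs : Term α
  rhs : Term α

namespace Equation

variable {α : Type u} {β : Type v}

/-- The set of indices that occur in an equation. -/
def ind (e : Equation α) : Set α := e.lhs.ind ∪ e.rhs.ind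

/-- Substitution in an equation. -/
def subst (σ : ℕ → Term α) (e : Equation α) : Equation α := ⟨e.lhs.subst σ, e.rhs.subst σ⟩

/-- For `e = e(x₁, …, xₙ)`, this is the equation `e(c_i x₁, …, c_i xₙ)`. -/
def cylVars (i : α) (e : Equation α) : Equation α := e.subst fun n => .cyl i (.var n)

/-- Renaming of the indices of the operations in an equation. -/
def rename (ρ : α → β) (e : Equation α) : Equation β := ⟨e.lhs.rename ρ, e.rhs.rename ρ⟩

/-- The Gödel number of an equation. -/
def code (e : Equation ℕ) : ℕ := Nat.pair e.lhs.code e.rhs.code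

end Equation

/-! ### Algebras, satisfaction, equational theories -/

/-- Algebras of the similarity type of cylindric algebras of dimension `α` (no axioms). -/
structure Alg (α : Type u) : Type (u + 1) where
  Carrier : Type u
  add : Carrier → Carrier → Carrier
  neg : Carrier → Carrier
  cyl : α → Carrier → Carrier
  diag : α → α → Carrier

/-- The value of a term in an algebra under an assignment of the variables. -/
def Term.eval {α : Type u} (A : Alg α) (x : ℕ → A.Carrier) : Term α → A.Carrier
  | .var n => x n
  | .add s t => A.add (s.eval A x) (t.eval A x)
  | .neg t => A.neg (t.eval A x)
  | .cyl i t => A.cyl i (t.eval A x)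
  | .diag i j => A.diag i j

/-- The equation `e` is valid in the algebra `A`. -/
def Alg.Satisfies {α : Type u} (A : Alg α) (e : Equation α) : Prop :=
  ∀ x : ℕ → A.Carrier, e.lhs.eval A x = e.rhs.eval A x

/-- `Eq(K)`: the set of all equations valid in all members of the class `K`. -/
def eqTheory {α : Type u} (K : Set (Alg α)) : Set (Equation α) :=
  {e | ∀ A ∈ K, A.Satisfies e}

/-- Homomorphisms of algebras. -/
structure IsHom {α : Type u} (A B : Alg α) (f : A.Carrier → B.Carrier) : Prop where
  map_add : ∀ a b, f (A.add a b) = B.add (f a) (f b)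
  map_neg : ∀ a, f (A.neg a) = B.neg (f a)
  map_cyl : ∀ i a, f (A.cyl i a) = B.cyl i (f a)
  map_diag : ∀ i j, f (A.diag i j) = B.diag i j

/-! ### Representable cylindric algebras -/

/-- The `α`-dimensional space over the set `W`: all sequences of type `α` with values in `W`. -/
def space (α : Type u) {U : Type u} (W : Set U) : Set (α → U) := {s | ∀ i, s i ∈ W}

/-- `V` is the union of a family of pairwise disjoint `α`-dimensional spaces. -/
def IsDisjointUnionOfSpaces {α U : Type u} (V : Set (α → U)) : Prop :=
  ∃ K : Set (Set U), K.PairwiseDisjoint (space α) ∧ V = ⋃ W ∈ K, space α W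

/-- The full cylindric set algebra with unit `V`. Its elements are the subsets of `V`; a point
`s ∈ V` is in `C_i X` iff it arises from a point of `X` by changing at most the value at `i`. -/
def fullSetAlg {α U : Type u} (V : Set (α → U)) : Alg α where
  Carrier := Set V
  add X Y := X ∪ Y
  neg X := Xᶜ
  cyl i X := {s | ∃ t ∈ X, ∀ j, j ≠ i → s.1 j = t.1 j}
  diag i j := {s | s.1 i = s.1 j}

/-- `RCA_α`: the algebras isomorphic to a subalgebra of (that is, embeddable into) a full
cylindric set algebra whose unit is a disjoint union of `α`-dimensional spaces. -/
def RCA (α : Type u) : Set (Alg α) :=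
  {A | ∃ (U : Type u) (V : Set (α → U)), IsDisjointUnionOfSpaces V ∧
    ∃ f : A.Carrier → (fullSetAlg V).Carrier, Function.Injective f ∧ IsHom A (fullSetAlg V) f}

/-! ### The axioms and the rules -/

open Term in
/-- The cylindric algebra axioms. The first group (`boole_…`) is the schema (C₀), which says that
`+` and `-` form a Boolean algebra; the others are (C₁)–(C₇). -/
inductive CAAxiom {α : Type u} : Equation α → Prop where
  | boole_add_comm : CAAxiom ⟨add (var 0) (var 1), add (var 1) (var 0)⟩
  | boole_mul_comm : CAAxiom ⟨mul (var 0) (var 1), mul (var 1) (var 0)⟩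
  | boole_add_assoc :
      CAAxiom ⟨add (add (var 0) (var 1)) (var 2), add (var 0) (add (var 1) (var 2))⟩
  | boole_mul_assoc :
      CAAxiom ⟨mul (mul (var 0) (var 1)) (var 2), mul (var 0) (mul (var 1) (var 2))⟩
  | boole_add_absorb : CAAxiom ⟨add (var 0) (mul (var 0) (var 1)), var 0⟩
  | boole_mul_absorb : CAAxiom ⟨mul (var 0) (add (var 0) (var 1)), var 0⟩
  | boole_mul_distrib :
      CAAxiom ⟨mul (var 0) (add (var 1) (var 2)), add (mul (var 0) (var 1)) (mul (var 0) (var 2))⟩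
  | boole_add_distrib :
      CAAxiom ⟨add (var 0) (mul (var 1) (var 2)), mul (add (var 0) (var 1)) (add (var 0) (var 2))⟩
  | boole_add_compl : CAAxiom ⟨add (var 0) (mul (var 1) (neg (var 1))), var 0⟩
  | boole_mul_compl : CAAxiom ⟨mul (var 0) (add (var 1) (neg (var 1))), var 0⟩
  | c1 (i : α) : CAAxiom ⟨cyl i zero, zero⟩
  | c2 (i : α) : CAAxiom ⟨add (var 0) (cyl i (var 0)), cyl i (var 0)⟩
  | c3 (i : α) :
      CAAxiom ⟨cyl i (mul (var 0) (cyl i (var 1))), mul (cyl i (var 0)) (cyl i (var 1))⟩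
  | c4 (i j : α) : CAAxiom ⟨cyl i (cyl j (var 0)), cyl j (cyl i (var 0))⟩
  | c5 (i : α) : CAAxiom ⟨diag i i, one⟩
  | c6 (i j k : α) (hi : k ≠ i) (hj : k ≠ j) :
      CAAxiom ⟨diag i j, cyl k (mul (diag i k) (diag k j))⟩
  | c7 (i j : α) (h : i ≠ j) :
      CAAxiom ⟨mul (cyl i (mul (diag i j) (var 0))) (cyl i (mul (diag i j) (neg (var 0)))), zero⟩

/-- `E` is closed under the five rules of equational logic: reflexivity, symmetry, transitivity,
replacement (congruence, for each basic operation), and substitution. -/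
structure ClosedUnderEquationalLogic {α : Type u} (E : Set (Equation α)) : Prop where
  refl : ∀ t : Term α, ⟨t, t⟩ ∈ E
  symm : ∀ s t : Term α, ⟨s, t⟩ ∈ E → ⟨t, s⟩ ∈ E
  trans : ∀ r s t : Term α, ⟨r, s⟩ ∈ E → ⟨s, t⟩ ∈ E → ⟨r, t⟩ ∈ E
  congr_add : ∀ s s' t t' : Term α, ⟨s, s'⟩ ∈ E → ⟨t, t'⟩ ∈ E → ⟨.add s t, .add s' t'⟩ ∈ E
  congr_neg : ∀ t t' : Term α, ⟨t, t'⟩ ∈ E → ⟨.neg t, .neg t'⟩ ∈ E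
  congr_cyl : ∀ (i : α) (t t' : Term α), ⟨t, t'⟩ ∈ E → ⟨.cyl i t, .cyl i t'⟩ ∈ E
  subst : ∀ (σ : ℕ → Term α) (e : Equation α), e ∈ E → e.subst σ ∈ E

/-- `E` is closed under the inductive rule: from `e(c_i x₁, …, c_i xₙ)` infer `e(x₁, …, xₙ)`,
provided that the index `i` does not occur in `e`. -/
def ClosedUnderInductiveRule {α : Type u} (E : Set (Equation α)) : Prop :=
  ∀ (e : Equation α) (i : α), i ∉ e.ind → e.cylVars i ∈ E → e ∈ E

end CylAlg

namespace CylAlg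

/-! Soundness turns on the inductive rule. As ind(e) is finite and α infinite, some injection φ of α
into itself fixes ind(e) pointwise and omits i from its range. The map s ↦ s ∘ φ sends the unit V
onto itself, preimages under it do not depend on the coordinate i, and taking preimages commutes
with every operation once its indices are renamed by φ. So the validity of e for c_i-fixed sets
gives its validity for all sets (`closedUnderInductiveRule_eqTheory_RCA`).

For minimality let E be a closed set of equations and e ∉ E. Since e has finitely many indices, it
comes from an equation over ℕ along an injection ρ, and the preimage of E under ρ is closed too. Let
N bound the indices of e. Divide the term algebra by the equations that follow when every variable
is fixed by all c_i with i ≥ N. The inductive rule strips these cylindrifications off again, so e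
still fails in the quotient (`mem_of_mem_relativized`). The quotient is a countable locally finite
cylindric algebra, in which c_i x is the supremum of the replacements s^i_k x.

A Henkin argument then applies (`IsCylindric.exists_representation`). The indices from N on serve as
constants, and a Rasiowa–Sikorski ultrafilter D gives every c_i x ∈ D with i < N a witness among
them. The base consists of the constants modulo the diagonals in D, and x is sent to the set of
those f for which replacing each i < N by the constant f i puts x into D. Only indices below N need
to be represented correctly, because e uses no others. The countermodel extends from ℕ to α along ρ
(`rename_notMem_eqTheory_RCA`).

Applied to the calculus over ℕ, the same argument shows that derivability of e is equivalent to
validity of ρ(e), whatever the injection ρ is. A primitive recursive enumeration of derivations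
finishes the proof (`Derivable.exists_nextCode`, `primrec_derivedCodes`). -/

/-- Cylindric algebras of dimension `ι`, as Boolean algebras with operators. -/
structure IsCylindric {ι B : Type*} [BooleanAlgebra B] (c : ι → B → B) (d : ι → ι → B) :
    Prop where
  cyl_bot : ∀ i, c i ⊥ = ⊥
  le_cyl : ∀ i x, x ≤ c i x
  cyl_inf_cyl : ∀ i x y, c i (x ⊓ c i y) = c i x ⊓ c i y
  cyl_comm : ∀ i j x, c i (c j x) = c j (c i x)
  diag_self : ∀ i, d i i = ⊤
  diag_eq : ∀ i j k, k ≠ i → k ≠ j → d i j = c k (d i k ⊓ d k j)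
  cyl_diag_inf : ∀ i j x, i ≠ j → c i (d i j ⊓ x) ⊓ c i (d i j ⊓ xᶜ) = ⊥

/-- Replacing the index `i` by `j` in a cylindric algebra. -/
def replace {ι B : Type*} [BooleanAlgebra B] (c : ι → B → B) (d : ι → ι → B) (i j : ι) (x : B) :
    B :=
  c i (d i j ⊓ x)

/-! ### Arithmetic of cylindrifications, diagonals and replacements -/

namespace IsCylindric

variable {ι B : Type*} [BooleanAlgebra B] {c : ι → B → B} {d : ι → ι → B}

theorem cyl_top (h : IsCylindric c d) (i : ι) : c i ⊤ = ⊤ := top_le_iff.1 (h.le_cyl i ⊤)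

theorem cyl_cyl (h : IsCylindric c d) (i : ι) (x : B) : c i (c i x) = c i x := by
  have := h.cyl_inf_cyl i ⊤ x
  simpa [h.cyl_top] using this

theorem cyl_mono (h : IsCylindric c d) (i : ι) {x y : B} (hxy : x ≤ y) : c i x ≤ c i y := by
  have h1 : x ⊓ c i y = x := inf_eq_left.2 (hxy.trans (h.le_cyl i y))
  have := h.cyl_inf_cyl i x y
  rw [h1] at this
  exact inf_eq_left.1 this.symm

/-- (C₃) applied to -x and x = c_i x gives c_i(-x) · x = c_i 0 = 0. -/
theorem cyl_compl (h : IsCylindric c d) (i : ι) {x : B} (hx : c i x = x) : c i xᶜ = xᶜ := by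
  refine le_antisymm ?_ (h.le_cyl i _)
  have := h.cyl_inf_cyl i xᶜ x
  rw [hx, compl_inf_eq_bot, h.cyl_bot] at this
  exact le_compl_iff_disjoint_right.2 (disjoint_iff.2 this.symm)

theorem cyl_inf_right (h : IsCylindric c d) (i : ι) (x : B) {y : B} (hy : c i y = y) :
    c i (x ⊓ y) = c i x ⊓ y := by
  have := h.cyl_inf_cyl i x y
  rwa [hy] at this

theorem cyl_inf_left (h : IsCylindric c d) (i : ι) (x : B) {y : B} (hy : c i y = y) :
    c i (y ⊓ x) = y ⊓ c i x := by
  rw [inf_comm, h.cyl_inf_right i x hy, inf_comm]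

theorem cyl_sup_fixed (h : IsCylindric c d) (i : ι) {x y : B} (hx : c i x = x) (hy : c i y = y) :
    c i (x ⊔ y) = x ⊔ y := by
  have h1 : c i (xᶜ ⊓ yᶜ) = xᶜ ⊓ yᶜ := by
    rw [h.cyl_inf_right i _ (h.cyl_compl i hy), h.cyl_compl i hx]
  have := h.cyl_compl i h1
  simpa [compl_inf] using this

/-- Additivity is not an axiom. It follows because the c_i-fixed elements form a Boolean subalgebra,
so that c_i x + c_i y is a fixed element above x + y. -/
theorem cyl_sup (h : IsCylindric c d) (i : ι) (x y : B) : c i (x ⊔ y) = c i x ⊔ c i y := by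
  apply le_antisymm
  · rw [← h.cyl_sup_fixed i (h.cyl_cyl i x) (h.cyl_cyl i y)]
    exact h.cyl_mono i (sup_le_sup (h.le_cyl i x) (h.le_cyl i y))
  · exact sup_le (h.cyl_mono i le_sup_left) (h.cyl_mono i le_sup_right)

theorem cyl_diag (h : IsCylindric c d) {i j k : ι} (hi : k ≠ i) (hj : k ≠ j) :
    c k (d i j) = d i j := by
  rw [h.diag_eq i j k hi hj, h.cyl_cyl]

/-- By (C₆), c_i(d_ij · d_ji) = d_jj = 1, so (C₇) with x = d_ji forces c_i(d_ij · -d_ji) = 0. -/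
theorem diag_le_symm (h : IsCylindric c d) {i j : ι} (hij : i ≠ j) : d i j ≤ d j i := by
  have h1 := h.cyl_diag_inf i j (d j i) hij
  rw [inf_comm (d i j) (d j i), ← h.diag_eq j j i hij hij, h.diag_self, top_inf_eq] at h1
  have h2 : d i j ⊓ (d j i)ᶜ = ⊥ := le_bot_iff.1 (h1 ▸ h.le_cyl i _)
  exact (disjoint_compl_right_iff.1 (disjoint_iff.2 h2))

theorem diag_symm (h : IsCylindric c d) (i j : ι) : d i j = d j i := by
  by_cases hij : i = j
  · rw [hij]
  · exact le_antisymm (h.diag_le_symm hij) (h.diag_le_symm (Ne.symm hij))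

theorem cyl_diag_left (h : IsCylindric c d) {i j : ι} (hij : i ≠ j) : c i (d i j) = ⊤ := by
  rw [← top_le_iff, ← h.diag_self j, h.diag_eq j j i hij hij]
  exact h.cyl_mono i inf_le_right

theorem diag_trans (h : IsCylindric c d) (i j k : ι) : d i j ⊓ d j k ≤ d i k := by
  by_cases hi : j = i
  · subst hi; exact inf_le_right
  by_cases hk : j = k
  · subst hk; exact inf_le_left
  rw [h.diag_eq i k j hi hk]
  exact h.le_cyl _ _

theorem replace_le (h : IsCylindric c d) (i j : ι) (x : B) : replace c d i j x ≤ c i x :=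
  h.cyl_mono i inf_le_right

theorem replace_sup (h : IsCylindric c d) (i j : ι) (x y : B) :
    replace c d i j (x ⊔ y) = replace c d i j x ⊔ replace c d i j y := by
  rw [replace, inf_sup_left, h.cyl_sup]; rfl

/-- (C₇) makes the two replacements disjoint; additivity and c_i d_ij = 1 make them cover the unit.
-/
theorem replace_compl (h : IsCylindric c d) {i j : ι} (hij : i ≠ j) (x : B) :
    replace c d i j xᶜ = (replace c d i j x)ᶜ := by
  refine (IsCompl.compl_eq ⟨disjoint_iff.2 (h.cyl_diag_inf i j x hij), codisjoint_iff.2 ?_⟩).symm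
  rw [← h.cyl_sup, ← inf_sup_left, sup_compl_eq_top, inf_top_eq, h.cyl_diag_left hij]

theorem replace_fixed (h : IsCylindric c d) {i j : ι} (hij : i ≠ j) {x : B} (hx : c i x = x) :
    replace c d i j x = x := by
  rw [replace, h.cyl_inf_right i _ hx, h.cyl_diag_left hij, top_inf_eq]

theorem replace_cyl (h : IsCylindric c d) {i j k : ι} (hi : k ≠ i) (hj : k ≠ j) (x : B) :
    replace c d i j (c k x) = c k (replace c d i j x) := by
  rw [replace, replace, h.cyl_comm k, h.cyl_inf_left k x (h.cyl_diag hi hj)]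

theorem replace_comm (h : IsCylindric c d) {i j k l : ι} (hki : k ≠ i) (hil : i ≠ l) (hkj : k ≠ j)
    (x : B) : replace c d i j (replace c d k l x) = replace c d k l (replace c d i j x) := by
  simp only [replace]
  rw [← h.cyl_inf_left k _ (h.cyl_diag hki hkj), ← h.cyl_inf_left i _ (h.cyl_diag hki.symm hil),
    h.cyl_comm, inf_left_comm]

theorem replace_diag [DecidableEq ι] (h : IsCylindric c d) {i l : ι} (hil : i ≠ l) (a b : ι) :
    replace c d i l (d a b) = d (if a = i then l else a) (if b = i then l else b) := by
  by_cases ha : a = i <;> by_cases hb : b = i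
  · subst ha; subst hb
    simp [h.diag_self, replace, h.cyl_diag_left hil]
  · subst ha
    rw [if_pos rfl, if_neg hb, replace, h.diag_symm a l, ← h.diag_eq l b a hil (Ne.symm hb)]
  · subst hb
    rw [if_pos rfl, if_neg ha, replace, inf_comm, ← h.diag_eq a l b (Ne.symm ha) hil]
  · rw [if_neg ha, if_neg hb, h.replace_fixed hil (h.cyl_diag (Ne.symm ha) (Ne.symm hb))]

/-- Substitution of equals. It allows a witness to be exchanged for the representative of its class.
-/
theorem diag_inf_replace_le (h : IsCylindric c d) {i k l : ι} (hk : i ≠ k) (hl : i ≠ l) (x : B) :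
    d k l ⊓ replace c d i k x ≤ replace c d i l x := by
  rw [replace, ← h.cyl_inf_left i _ (h.cyl_diag hk hl)]
  refine h.cyl_mono i (le_inf ?_ (inf_le_right.trans inf_le_right))
  calc d k l ⊓ (d i k ⊓ x) ≤ d i k ⊓ d k l := by
        rw [← inf_assoc, inf_comm (d k l)]; exact inf_le_left
    _ ≤ d i l := h.diag_trans i k l

/-- `c_i x` is the least upper bound of the elements `s^i_k x`. -/
theorem cyl_le_of_replace_le (h : IsCylindric c d) {i k : ι} (hik : i ≠ k) {x z : B}
    (hx : c k x = x) (hz : c k z = z) (hle : replace c d i k x ≤ z) : c i x ≤ z := by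
  have := h.cyl_mono k hle
  -- Applying c_k leaves z alone and removes the diagonal from s^i_k x, because x is c_k-fixed and
  -- c_k d_ik = 1.
  rw [hz, replace, h.cyl_comm, h.cyl_inf_right k _ hx, h.diag_symm, h.cyl_diag_left hik.symm,
    top_inf_eq] at this
  exact this

end IsCylindric

/-! ### Simultaneous replacement -/

section Multi

variable {B : Type*} [BooleanAlgebra B] {c : ℕ → B → B} {d : ℕ → ℕ → B}

/-- Replace each index `i < n` by `N + f i`. -/
def multiReplace (c : ℕ → B → B) (d : ℕ → ℕ → B) (N : ℕ) (f : ℕ → ℕ) : ℕ → B → B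
  | 0, x => x
  | n + 1, x => replace c d n (N + f n) (multiReplace c d N f n x)

variable {N : ℕ}

theorem multiReplace_congr {f g : ℕ → ℕ} {n : ℕ} (hfg : ∀ i < n, f i = g i) (x : B) :
    multiReplace c d N f n x = multiReplace c d N g n x := by
  induction n with
  | zero => rfl
  | succ n ih =>
    rw [multiReplace, multiReplace, ih fun i hi => hfg i (by omega), hfg n (by omega)]

theorem IsCylindric.multiReplace_sup (h : IsCylindric c d) (f : ℕ → ℕ) (n : ℕ) (x y : B) :
    multiReplace c d N f n (x ⊔ y) = multiReplace c d N f n x ⊔ multiReplace c d N f n y := by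
  induction n with
  | zero => rfl
  | succ n ih => simp only [multiReplace, ih, h.replace_sup]

theorem IsCylindric.multiReplace_compl (h : IsCylindric c d) (f : ℕ → ℕ) {n : ℕ} (hn : n ≤ N)
    (x : B) : multiReplace c d N f n xᶜ = (multiReplace c d N f n x)ᶜ := by
  induction n with
  | zero => rfl
  | succ n ih =>
    simp only [multiReplace]
    rw [ih (by omega), h.replace_compl (by omega)]

theorem IsCylindric.multiReplace_fixed (h : IsCylindric c d) (f : ℕ → ℕ) {n : ℕ} (hn : n ≤ N)
    {x : B} (hx : ∀ i < n, c i x = x) : multiReplace c d N f n x = x := by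
  induction n with
  | zero => rfl
  | succ n ih =>
    rw [multiReplace, ih (by omega) fun i hi => hx i (by omega),
      h.replace_fixed (by omega) (hx n (by omega))]

theorem IsCylindric.multiReplace_diag (h : IsCylindric c d) (f : ℕ → ℕ) {n : ℕ} (hn : n ≤ N)
    {i j : ℕ} (hi : i < N) (hj : j < N) :
    multiReplace c d N f n (d i j) =
      d (if i < n then N + f i else i) (if j < n then N + f j else j) := by
  induction n with
  | zero => simp [multiReplace]
  | succ n ih =>
    rw [multiReplace, ih (by omega), h.replace_diag (by omega)]
    congr 1
    · split_ifs <;> first | omega | (have : i = n := by omega); subst this; rfl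
    · split_ifs <;> first | omega | (have : j = n := by omega); subst this; rfl

theorem IsCylindric.multiReplace_cyl_of_le (h : IsCylindric c d) (f : ℕ → ℕ) {n i : ℕ}
    (hn : n ≤ i) (hi : i < N) (x : B) :
    multiReplace c d N f n (c i x) = c i (multiReplace c d N f n x) := by
  induction n with
  | zero => rfl
  | succ n ih => rw [multiReplace, ih (by omega), h.replace_cyl (by omega) (by omega)]; rfl

/-- The replacement of i commutes with the others, since all targets are at least N, and can be made
outermost; y is what the others produce. This reduces the cylindrification clause of the
representation to a single replacement. -/
theorem IsCylindric.exists_multiReplace (h : IsCylindric c d) (f : ℕ → ℕ) {n i : ℕ}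
    (hin : i < n) (hn : n ≤ N) (x : B) :
    ∃ y, multiReplace c d N f n (c i x) = c i y ∧
      ∀ k, multiReplace c d N (Function.update f i k) n x = replace c d i (N + k) y := by
  induction n with
  | zero => omega
  | succ n ih =>
    rcases Nat.lt_succ_iff_lt_or_eq.1 hin with hlt | rfl
    · obtain ⟨y, hy1, hy2⟩ := ih hlt (by omega)
      refine ⟨replace c d n (N + f n) y, ?_, fun k => ?_⟩
      · rw [multiReplace, hy1, h.replace_cyl (by omega) (by omega)]
      · rw [multiReplace, hy2, Function.update_of_ne (by omega),
          h.replace_comm (by omega) (by omega) (by omega)]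
    · refine ⟨multiReplace c d N f i x, ?_, fun k => ?_⟩
      · rw [multiReplace, h.multiReplace_cyl_of_le f le_rfl (by omega),
          h.replace_fixed (by omega) (h.cyl_cyl i _)]
      · rw [multiReplace, Function.update_self]
        congr 1
        exact multiReplace_congr (fun j hj => Function.update_of_ne (by omega) _ _) x

/-- The iterated cylindrification `c_a c_{a+1} … c_{a+m-1}`. -/
def iterCyl (c : ℕ → B → B) (a : ℕ) : ℕ → B → B
  | 0, x => x
  | m + 1, x => iterCyl c a m (c (a + m) x)

theorem IsCylindric.iterCyl_cyl_comm (h : IsCylindric c d) (a m i : ℕ) (x : B) :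
    iterCyl c a m (c i x) = c i (iterCyl c a m x) := by
  induction m generalizing x with
  | zero => rfl
  | succ m ih => rw [iterCyl, h.cyl_comm, ih]; rfl

theorem IsCylindric.cyl_iterCyl (h : IsCylindric c d) {a m i : ℕ} (ha : a ≤ i) (hm : i < a + m)
    (x : B) : c i (iterCyl c a m x) = iterCyl c a m x := by
  induction m generalizing x with
  | zero => omega
  | succ m ih =>
    rw [iterCyl]
    by_cases hi : i = a + m
    · rw [← h.iterCyl_cyl_comm, hi, h.cyl_cyl]
    · exact ih (by omega) _

theorem IsCylindric.le_iterCyl (h : IsCylindric c d) (a m : ℕ) (x : B) : x ≤ iterCyl c a m x := by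
  induction m generalizing x with
  | zero => exact le_rfl
  | succ m ih => exact (h.le_cyl _ x).trans (ih _)

end Multi

/-! ### Ultrafilters that preserve countably many joins -/

/-- The Rasiowa–Sikorski lemma, for ultrafilters given as sets. -/
theorem exists_generic_ultrafilter {B J : Type*} [BooleanAlgebra B] [Countable B] [Countable J]
    {K : Type*} (s : J → B) (r : J → K → B)
    (hs : ∀ j z, (∀ k, r j k ≤ z) → s j ≤ z) {a : B} (ha : a ≠ ⊥) :
    ∃ D : Set B, a ∈ D ∧ ⊥ ∉ D ∧ (∀ x y, x ∈ D → x ≤ y → y ∈ D) ∧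
      (∀ x y, x ∈ D → y ∈ D → x ⊓ y ∈ D) ∧ (∀ x, x ∈ D ∨ xᶜ ∈ D) ∧
      ∀ j, s j ∈ D → ∃ k, r j k ∈ D := by
  classical
  have key : ∀ x y : B, x ≠ ⊥ → ¬ x ≤ yᶜ → x ⊓ y ≠ ⊥ := fun x y _ h h' =>
    h (le_compl_iff_disjoint_right.2 (disjoint_iff.2 h'))
  let P := {x : B // x ≠ ⊥}ᵒᵈ
  -- In the nonzero elements under the reversed order, ideals are filters of B. The sets for `.inl
  -- b` decide b, which makes the filter an ultrafilter; those for `.inr j` either refute s j or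
  -- provide a witness r j k.
  let 𝒟 : B ⊕ J → Order.Cofinal P := fun q => match q with
    | .inl b => ⟨{x | (OrderDual.ofDual x).1 ≤ b ∨ (OrderDual.ofDual x).1 ≤ bᶜ}, by
        intro x
        by_cases hx : (OrderDual.ofDual x).1 ≤ bᶜ
        · exact ⟨x, Or.inr hx, le_rfl⟩
        · exact ⟨OrderDual.toDual ⟨(OrderDual.ofDual x).1 ⊓ b, key _ _ (OrderDual.ofDual x).2 hx⟩,
            Or.inl inf_le_right, show (OrderDual.ofDual x).1 ⊓ b ≤ _ from inf_le_left⟩⟩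
    | .inr j => ⟨{x | (OrderDual.ofDual x).1 ≤ (s j)ᶜ ∨ ∃ k, (OrderDual.ofDual x).1 ≤ r j k}, by
        intro x
        by_cases hx : ∀ k, (OrderDual.ofDual x).1 ≤ (r j k)ᶜ
        · refine ⟨x, Or.inl ?_, le_rfl⟩
          rw [le_compl_comm]
          exact hs j _ fun k => le_compl_comm.1 (hx k)
        · push Not at hx
          obtain ⟨k, hk⟩ := hx
          exact ⟨OrderDual.toDual ⟨(OrderDual.ofDual x).1 ⊓ r j k,
            key _ _ (OrderDual.ofDual x).2 hk⟩, Or.inr ⟨k, inf_le_right⟩,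
            show (OrderDual.ofDual x).1 ⊓ r j k ≤ _ from inf_le_left⟩⟩
  have : Encodable (B ⊕ J) := Encodable.ofCountable _
  let p : P := OrderDual.toDual ⟨a, ha⟩
  let G := Order.idealOfCofinals p 𝒟
  refine ⟨{b | ∃ x ∈ G, (OrderDual.ofDual x).1 ≤ b}, ⟨p, Order.mem_idealOfCofinals p 𝒟, le_rfl⟩,
    ?_, ?_, ?_, ?_, ?_⟩
  · rintro ⟨x, -, hx⟩
    exact (OrderDual.ofDual x).2 (le_bot_iff.1 hx)
  · rintro x y ⟨z, hz, hzx⟩ hxy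
    exact ⟨z, hz, hzx.trans hxy⟩
  · rintro x y ⟨z, hz, hzx⟩ ⟨w, hw, hwy⟩
    obtain ⟨v, hv, h1, h2⟩ := G.directed z hz w hw
    exact ⟨v, hv, le_inf (le_trans h1 hzx) (le_trans h2 hwy)⟩
  · intro x
    obtain ⟨z, hz1, hz2⟩ := Order.cofinal_meets_idealOfCofinals p 𝒟 (.inl x)
    rcases hz1 with h | h
    · exact Or.inl ⟨z, hz2, h⟩
    · exact Or.inr ⟨z, hz2, h⟩
  · rintro j ⟨x, hx, hxs⟩
    obtain ⟨z, hz1, hz2⟩ := Order.cofinal_meets_idealOfCofinals p 𝒟 (.inr j)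
    rcases hz1 with h | ⟨k, h⟩
    · obtain ⟨v, hv, h1, h2⟩ := G.directed x hx z hz2
      have h3 : (OrderDual.ofDual v).1 ≤ s j := le_trans h1 hxs
      have h4 : (OrderDual.ofDual v).1 ≤ (s j)ᶜ := le_trans h2 h
      exact absurd (le_bot_iff.1 ((le_inf h3 h4).trans_eq inf_compl_eq_bot)) (OrderDual.ofDual v).2
    · exact ⟨k, z, hz2, h⟩

/-! ### Representation of countable locally finite cylindric algebras -/

/-- A countable locally finite cylindric algebra of dimension `ω` is represented, as far as the
indices below `N` are concerned, by the subsets of a space, with a given nonzero element not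
mapped to the empty set. -/
theorem IsCylindric.exists_representation {B : Type*} [BooleanAlgebra B] [Countable B]
    {c : ℕ → B → B} {d : ℕ → ℕ → B} (h : IsCylindric c d)
    (hfin : ∀ x, ∃ m, ∀ i, m ≤ i → c i x = x) (N : ℕ) {a : B} (ha : a ≠ ⊥) :
    ∃ (W : Set ℕ) (H : B → Set (space ℕ W)),
      (∀ x y, H (x ⊔ y) = H x ∪ H y) ∧ (∀ x, H xᶜ = (H x)ᶜ) ∧
      (∀ i < N, ∀ x, H (c i x) = (fullSetAlg (space ℕ W)).cyl i (H x)) ∧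
      (∀ i < N, ∀ j < N, H (d i j) = (fullSetAlg (space ℕ W)).diag i j) ∧ (H a).Nonempty := by
  classical
  -- Local finiteness supplies a constant N + (m + m') fresh for both x and z. The element put into
  -- D is c_0 … c_{N-1} a, not a: it does not depend on the indices below N, so no replacement of
  -- them changes it.
  obtain ⟨D, haD, hbot, hup, hinf, hult, hgen⟩ := exists_generic_ultrafilter
    (fun q : Fin N × B => c q.1 q.2) (fun q (k : ℕ) => replace c d q.1 (N + k) q.2) (by
      rintro ⟨i, x⟩ z hz
      obtain ⟨m, hm⟩ := hfin x
      obtain ⟨m', hm'⟩ := hfin z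
      exact h.cyl_le_of_replace_le (k := N + (m + m')) (by have := i.2; omega) (hm _ (by omega))
        (hm' _ (by omega)) (hz (m + m')))
    (a := iterCyl c 0 N a) fun h' => ha (le_bot_iff.1 (h' ▸ h.le_iterCyl 0 N a))
  have hcompl : ∀ x, xᶜ ∈ D ↔ x ∉ D := fun x =>
    ⟨fun h1 h2 => hbot (by simpa using hinf _ _ h2 h1), fun h1 => (hult x).resolve_left h1⟩
  have hsup : ∀ x y, x ⊔ y ∈ D ↔ x ∈ D ∨ y ∈ D := fun x y => by
    refine ⟨fun h1 => ?_, fun h1 => h1.elim (hup _ _ · le_sup_left) (hup _ _ · le_sup_right)⟩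
    by_contra h2
    push Not at h2
    have h3 := hinf _ _ ((hcompl x).2 h2.1) ((hcompl y).2 h2.2)
    rw [← compl_sup] at h3
    exact (hcompl _).1 h3 h1
  have htop : ⊤ ∈ D := hup _ _ haD le_top
  -- The condition d_{N+k,N+l} ∈ D is an equivalence between k and l. Keeping only the least member
  -- of each class turns it into equality on W, so no quotient is needed.
  let W : Set ℕ := {k | ∀ l < k, d (N + l) (N + k) ∉ D}
  have hrep : ∀ k, ∃ l ∈ W, d (N + k) (N + l) ∈ D := fun k => by
    have hex : ∃ l, d (N + k) (N + l) ∈ D := ⟨k, by rw [h.diag_self]; exact htop⟩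
    refine ⟨Nat.find hex, fun l hl hD => Nat.find_min hex hl ?_, Nat.find_spec hex⟩
    refine hup _ _ (hinf _ _ (Nat.find_spec hex) hD) ?_
    rw [h.diag_symm (N + l)]
    exact h.diag_trans _ _ _
  have hWeq : ∀ k ∈ W, ∀ l ∈ W, d (N + k) (N + l) ∈ D ↔ k = l := fun k hk l hl => by
    refine ⟨fun hD => ?_, fun hkl => by rw [hkl, h.diag_self]; exact htop⟩
    rcases lt_trichotomy k l with hlt | heq | hlt
    · exact absurd hD (hl k hlt)
    · exact heq
    · exact absurd (h.diag_symm _ _ ▸ hD) (hk l hlt)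
  let H : B → Set (space ℕ W) := fun x => {f | multiReplace c d N f.1 N x ∈ D}
  have hcyl : ∀ i < N, ∀ x, H (c i x) = (fullSetAlg (space ℕ W)).cyl i (H x) := by
    intro i hi x
    ext f
    obtain ⟨y, hy1, hy2⟩ := h.exists_multiReplace f.1 hi le_rfl x
    change multiReplace c d N f.1 N (c i x) ∈ D ↔
      ∃ g : space ℕ W, multiReplace c d N g.1 N x ∈ D ∧ ∀ j, j ≠ i → f.1 j = g.1 j
    rw [hy1]
    constructor
    · intro hD
      obtain ⟨k, hk⟩ := hgen (⟨i, hi⟩, y) hD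
      -- The generic witness k need not lie in W; its representative l does, and works equally well.
      obtain ⟨l, hl, hkl⟩ := hrep k
      refine ⟨⟨Function.update f.1 i l, fun j => ?_⟩, ?_, fun j hj => ?_⟩
      · by_cases hj : j = i
        · subst hj; simpa using hl
        · simpa [hj] using f.2 j
      · rw [hy2]
        exact hup _ _ (hinf _ _ hkl hk) (h.diag_inf_replace_le (by omega) (by omega) y)
      · simp [hj]
    · rintro ⟨g, hg, hfg⟩
      have : g.1 = Function.update f.1 i (g.1 i) := by
        ext j
        by_cases hj : j = i
        · subst hj; simp
        · simp [hj, hfg j hj]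
      rw [this, hy2] at hg
      exact hup _ _ hg (h.replace_le _ _ _)
  have hne : ∀ n ≤ N, ∀ x, (H (iterCyl c 0 n x)).Nonempty → (H x).Nonempty := by
    intro n
    induction n with
    | zero => exact fun _ x hx => hx
    | succ n ih =>
      intro hn x hx
      have := ih (by omega) _ hx
      rw [hcyl _ (by omega)] at this
      obtain ⟨f, g, hg, -⟩ := this
      exact ⟨g, hg⟩
  refine ⟨W, H, fun x y => ?_, fun x => ?_, hcyl, fun i hi j hj => ?_, hne N le_rfl a ?_⟩
  · ext f
    change multiReplace c d N f.1 N (x ⊔ y) ∈ D ↔ _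
    rw [h.multiReplace_sup, hsup]; rfl
  · ext f
    change multiReplace c d N f.1 N xᶜ ∈ D ↔ _
    rw [h.multiReplace_compl _ le_rfl, hcompl]; rfl
  · ext f
    change multiReplace c d N f.1 N (d i j) ∈ D ↔ f.1 i = f.1 j
    rw [h.multiReplace_diag _ le_rfl hi hj, if_pos hi, if_pos hj, hWeq _ (f.2 i) _ (f.2 j)]
  -- The number 0 belongs to W vacuously. Any point would do, as c_0 … c_{N-1} a is invariant under
  -- the replacements.
  · refine ⟨⟨fun _ => 0, fun _ l hl => absurd hl (Nat.not_lt_zero l)⟩, ?_⟩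
    change multiReplace c d N _ N (iterCyl c 0 N a) ∈ D
    rw [h.multiReplace_fixed _ le_rfl fun i hi => h.cyl_iterCyl (by omega) (by omega) a]
    exact haD

end CylAlg

namespace CylAlg

/-! ### Terms, codes, substitution -/

namespace Term

theorem unpair_snd_lt {n : ℕ} (h : n.unpair.1 ≠ 0) : n.unpair.2 < n := by
  have := Nat.add_le_pair n.unpair.1 n.unpair.2
  rw [Nat.pair_unpair] at this
  omega

/-- The term with a given code; numbers that are not codes are read as terms, too. -/
def decode (n : ℕ) : Term ℕ :=
  if _h0 : n.unpair.1 = 0 then .var n.unpair.2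
  else if n.unpair.1 = 1 then
    .add (decode n.unpair.2.unpair.1) (decode n.unpair.2.unpair.2)
  else if n.unpair.1 = 2 then .neg (decode n.unpair.2)
  else if n.unpair.1 = 3 then .cyl n.unpair.2.unpair.1 (decode n.unpair.2.unpair.2)
  else .diag n.unpair.2.unpair.1 n.unpair.2.unpair.2
termination_by n
decreasing_by
  all_goals have h1 := unpair_snd_lt _h0
  · exact (Nat.unpair_left_le _).trans_lt h1
  · exact (Nat.unpair_right_le _).trans_lt h1
  · exact h1
  · exact (Nat.unpair_right_le _).trans_lt h1

@[simp] theorem decode_pair_zero (n : ℕ) : decode (Nat.pair 0 n) = .var n := by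
  rw [decode]; simp

@[simp] theorem decode_pair_one (m n : ℕ) :
    decode (Nat.pair 1 (Nat.pair m n)) = .add (decode m) (decode n) := by
  rw [decode]; simp

@[simp] theorem decode_pair_two (n : ℕ) : decode (Nat.pair 2 n) = .neg (decode n) := by
  rw [decode]; simp

@[simp] theorem decode_pair_three (i n : ℕ) :
    decode (Nat.pair 3 (Nat.pair i n)) = .cyl i (decode n) := by
  rw [decode]; simp

@[simp] theorem decode_pair_four (i j : ℕ) :
    decode (Nat.pair 4 (Nat.pair i j)) = .diag i j := by
  rw [decode]; simp

@[simp] theorem decode_code (t : Term ℕ) : decode t.code = t := by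
  induction t <;> simp_all [code]

theorem code_injective : Function.Injective code :=
  Function.LeftInverse.injective decode_code

instance : Countable (Term ℕ) := code_injective.countable

variable {α : Type*}

theorem subst_subst (σ τ : ℕ → Term α) (t : Term α) :
    (t.subst σ).subst τ = t.subst fun n => (σ n).subst τ := by
  induction t <;> simp_all [subst]

@[simp] theorem subst_var (t : Term α) : t.subst var = t := by
  induction t <;> simp_all [subst]

theorem ind_finite (t : Term α) : t.ind.Finite := by
  induction t <;> simp_all [ind]

theorem eval_subst (A : Alg α) (x : ℕ → A.Carrier) (σ : ℕ → Term α) (t : Term α) :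
    (t.subst σ).eval A x = t.eval A fun n => (σ n).eval A x := by
  induction t <;> simp_all [subst, eval]

/-- The term `c_a c_{a+1} … c_{a+m-1} t`. -/
def iterCyl (a : ℕ) : ℕ → Term ℕ → Term ℕ
  | 0, t => t
  | m + 1, t => iterCyl a m (.cyl (a + m) t)

theorem subst_iterCyl (a m : ℕ) (σ : ℕ → Term ℕ) (t : Term ℕ) :
    (iterCyl a m t).subst σ = iterCyl a m (t.subst σ) := by
  induction m generalizing t with
  | zero => rfl
  | succ m ih => rw [iterCyl, ih]; rfl

theorem ind_iterCyl {a m i : ℕ} {t : Term ℕ} (hi : i ∈ (iterCyl a m t).ind) :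
    i < a + m ∨ i ∈ t.ind := by
  induction m generalizing t with
  | zero => exact Or.inr hi
  | succ m ih =>
    rcases ih hi with h | h | h
    · exact Or.inl (by omega)
    · rw [Set.mem_singleton_iff] at h; exact Or.inl (by omega)
    · exact Or.inr h

theorem mem_ind_subst {σ : ℕ → Term α} {t : Term α} {i : α} (hi : i ∈ (t.subst σ).ind) :
    i ∈ t.ind ∨ ∃ n, i ∈ (σ n).ind := by
  induction t with
  | var n => exact Or.inr ⟨n, hi⟩
  | add s t hs ht =>
    rcases hi with h | h
    · exact (hs h).imp_left Or.inl
    · exact (ht h).imp_left Or.inr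
  | neg t ht => exact ht hi
  | cyl j t ht =>
    rcases hi with h | h
    · exact Or.inl (Or.inl h)
    · exact (ht h).imp_left Or.inr
  | diag j k => exact Or.inl hi

end Term

theorem Equation.subst_subst {α : Type*} (σ τ : ℕ → Term α) (e : Equation α) :
    (e.subst σ).subst τ = e.subst fun n => (σ n).subst τ := by
  simp [Equation.subst, Term.subst_subst]

@[simp] theorem Equation.subst_var {α : Type*} (e : Equation α) : e.subst Term.var = e := by
  simp [Equation.subst]

theorem Equation.ind_finite {α : Type*} (e : Equation α) : e.ind.Finite :=
  e.lhs.ind_finite.union e.rhs.ind_finite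

/-! ### Algebras that satisfy the cylindric algebra axioms -/

section Abstract

variable {α : Type*} {A : Alg α}

/-- The assignment with values `x`, `y`, `z`, `z`, …. -/
def assign {C : Type*} (x y z : C) : ℕ → C
  | 0 => x
  | 1 => y
  | _ => z

/-- The Boolean reduct of an algebra that satisfies the cylindric algebra axioms. -/
abbrev Alg.booleanAlgebra (hA : ∀ e, CAAxiom e → A.Satisfies e) (o : A.Carrier) :
    BooleanAlgebra A.Carrier :=
  letI : Max A.Carrier := ⟨A.add⟩
  letI : Min A.Carrier := ⟨fun x y => A.neg (A.add (A.neg x) (A.neg y))⟩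
  letI L : Lattice A.Carrier := Lattice.mk'
    (fun x y => hA _ .boole_add_comm (assign x y y))
    (fun x y z => hA _ .boole_add_assoc (assign x y z))
    (fun x y => hA _ .boole_mul_comm (assign x y y))
    (fun x y z => hA _ .boole_mul_assoc (assign x y z))
    (fun x y => hA _ .boole_add_absorb (assign x y y))
    (fun x y => hA _ .boole_mul_absorb (assign x y y))
  letI D : DistribLattice A.Carrier := DistribLattice.ofInfSupLe
    fun x y z => (show x ⊓ (y ⊔ z) = (x ⊓ y) ⊔ (x ⊓ z) from
      hA _ .boole_mul_distrib (assign x y z)).le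
  have htop : ∀ x y : A.Carrier, x ≤ y ⊔ A.neg y := fun x y =>
    inf_eq_left.1 (hA _ .boole_mul_compl (assign x y y))
  have hbot : ∀ x y : A.Carrier, y ⊓ A.neg y ≤ x := fun x y =>
    sup_eq_left.1 (hA _ .boole_add_compl (assign x y y))
  { D with
    compl := A.neg
    top := A.add o (A.neg o)
    bot := A.neg (A.add o (A.neg o))
    le_top := fun x => htop x o
    bot_le := fun x => by
      -- All elements of the form y + -y are the greatest one; with y = -x the zero becomes x · -x
      -- by the definition of the meet.
      have h : A.add o (A.neg o) = A.add (A.neg x) (A.neg (A.neg x)) :=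
        le_antisymm (htop _ _) (htop _ _)
      rw [h]
      exact hbot x x
    inf_compl_le_bot := fun x => hbot _ x
    top_le_sup_compl := fun x => htop _ x }

theorem Alg.isCylindric (hA : ∀ e, CAAxiom e → A.Satisfies e) (o : A.Carrier) :
    letI := Alg.booleanAlgebra hA o
    IsCylindric A.cyl A.diag :=
  letI := Alg.booleanAlgebra hA o
  { cyl_bot := fun i => hA _ (.c1 i) (assign o o o)
    le_cyl := fun i x => sup_eq_right.1 (hA _ (.c2 i) (assign x x x))
    cyl_inf_cyl := fun i x y => hA _ (.c3 i) (assign x y y)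
    cyl_comm := fun i j x => hA _ (.c4 i j) (assign x x x)
    diag_self := fun i => hA _ (.c5 i) (assign o o o)
    diag_eq := fun i j k hi hj => hA _ (.c6 i j k hi hj) (assign o o o)
    cyl_diag_inf := fun i j x hij => by
      -- The term for zero contains x₀, which is assigned x here, whereas ⊥ was built from o.
      have h1 : A.add x (A.neg x) = A.add o (A.neg o) :=
        sup_compl_eq_top (x := x)
      have h2 := hA _ (.c7 i j hij) (assign x x x)
      exact h2.trans (congrArg A.neg h1) }

end Abstract

/-! ### Quotients of the term algebra -/

section Quotient

variable {α : Type u} {E : Set (Equation α)}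

/-- A congruence of the term algebra, given as a set of equations. -/
structure IsCongruence (E : Set (Equation α)) : Prop where
  refl : ∀ t : Term α, ⟨t, t⟩ ∈ E
  symm : ∀ s t : Term α, ⟨s, t⟩ ∈ E → ⟨t, s⟩ ∈ E
  trans : ∀ r s t : Term α, ⟨r, s⟩ ∈ E → ⟨s, t⟩ ∈ E → ⟨r, t⟩ ∈ E
  congr_add : ∀ s s' t t' : Term α, ⟨s, s'⟩ ∈ E → ⟨t, t'⟩ ∈ E → ⟨.add s t, .add s' t'⟩ ∈ E
  congr_neg : ∀ t t' : Term α, ⟨t, t'⟩ ∈ E → ⟨.neg t, .neg t'⟩ ∈ E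
  congr_cyl : ∀ (i : α) (t t' : Term α), ⟨t, t'⟩ ∈ E → ⟨.cyl i t, .cyl i t'⟩ ∈ E

theorem ClosedUnderEquationalLogic.isCongruence (hE : ClosedUnderEquationalLogic E) :
    IsCongruence E :=
  ⟨hE.refl, hE.symm, hE.trans, hE.congr_add, hE.congr_neg, hE.congr_cyl⟩

/-- The equivalence relation of a congruence. -/
def IsCongruence.setoid (hE : IsCongruence E) : Setoid (Term α) :=
  ⟨fun s t => ⟨s, t⟩ ∈ E, hE.refl, hE.symm _ _, hE.trans _ _ _⟩

/-- The quotient of the term algebra by a congruence. -/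
def IsCongruence.quotient (hE : IsCongruence E) : Alg α where
  Carrier := Quotient hE.setoid
  add := Quotient.map₂ Term.add fun _ _ h _ _ h' => hE.congr_add _ _ _ _ h h'
  neg := Quotient.map Term.neg fun _ _ h => hE.congr_neg _ _ h
  cyl i := Quotient.map (Term.cyl i) fun _ _ h => hE.congr_cyl i _ _ h
  diag i j := Quotient.mk _ (Term.diag i j)

/-- The class of a term. -/
def IsCongruence.cls (hE : IsCongruence E) (t : Term α) : hE.quotient.Carrier :=
  Quotient.mk hE.setoid t

theorem IsCongruence.cls_eq_cls (hE : IsCongruence E) {s t : Term α} :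
    hE.cls s = hE.cls t ↔ ⟨s, t⟩ ∈ E :=
  ⟨fun h => Quotient.exact h, fun h => Quotient.sound h⟩

theorem IsCongruence.cls_surjective (hE : IsCongruence E) : Function.Surjective hE.cls :=
  Quotient.mk_surjective

theorem IsCongruence.eval_cls (hE : IsCongruence E) (σ : ℕ → Term α) (t : Term α) :
    t.eval hE.quotient (fun n => hE.cls (σ n)) = hE.cls (t.subst σ) := by
  induction t with
  | var n => rfl
  | add s t hs ht => rw [Term.eval, hs, ht]; rfl
  | neg t ht => rw [Term.eval, ht]; rfl
  | cyl i t ht => rw [Term.eval, ht]; rfl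
  | diag i j => rfl

/-- Closure under substitution is required for the single equation e only, because a relativized
theory need not be closed under substitution. -/
theorem IsCongruence.quotient_satisfies (hE : IsCongruence E) {e : Equation α}
    (he : ∀ σ, e.subst σ ∈ E) : hE.quotient.Satisfies e := by
  intro x
  choose σ hσ using fun n => hE.cls_surjective (x n)
  obtain rfl : (fun n => hE.cls (σ n)) = x := funext hσ
  rw [hE.eval_cls, hE.eval_cls]
  exact hE.cls_eq_cls.2 (he σ)

end Quotient

/-! ### Completeness over the index set `ℕ` -/

section Completeness

variable {E : Set (Equation ℕ)}

/-- The equations that follow from `E` if the variables are fixed by `c_i` for all `i ≥ N`. -/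
def relativized (E : Set (Equation ℕ)) (N : ℕ) : Set (Equation ℕ) :=
  {e | ∃ m, e.subst (fun n => Term.iterCyl N m (.var n)) ∈ E}

/-- Substituting c_{N+k} x for each variable x adds one more cylindrification. Hence several
premises can be brought to a common m. -/
theorem subst_iterCyl_mono (hE : ClosedUnderEquationalLogic E) {N m m' : ℕ} (hm : m ≤ m')
    {e : Equation ℕ} (he : e.subst (fun n => Term.iterCyl N m (.var n)) ∈ E) :
    e.subst (fun n => Term.iterCyl N m' (.var n)) ∈ E := by
  induction m', hm using Nat.le_induction with
  | base => exact he
  | succ k hk ih =>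
    have := hE.subst (fun n => .cyl (N + k) (.var n)) _ ih
    rw [Equation.subst_subst] at this
    simp only [Term.subst_iterCyl] at this
    exact this

theorem isCongruence_relativized (hE : ClosedUnderEquationalLogic E) (N : ℕ) :
    IsCongruence (relativized E N) where
  refl _ := ⟨0, hE.refl _⟩
  symm := by
    rintro s t ⟨m, h⟩
    exact ⟨m, hE.symm _ _ h⟩
  trans := by
    rintro r s t ⟨m, h⟩ ⟨m', h'⟩
    have h1 := subst_iterCyl_mono hE (le_max_left m m') h
    have h2 := subst_iterCyl_mono hE (le_max_right m m') h'
    exact ⟨max m m', hE.trans _ _ _ h1 h2⟩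
  congr_add := by
    rintro s s' t t' ⟨m, h⟩ ⟨m', h'⟩
    have h1 := subst_iterCyl_mono hE (le_max_left m m') h
    have h2 := subst_iterCyl_mono hE (le_max_right m m') h'
    exact ⟨max m m', hE.congr_add _ _ _ _ h1 h2⟩
  congr_neg := by
    rintro t t' ⟨m, h⟩
    exact ⟨m, hE.congr_neg _ _ h⟩
  congr_cyl := by
    rintro i t t' ⟨m, h⟩
    exact ⟨m, hE.congr_cyl i _ _ h⟩

theorem subset_relativized (N : ℕ) : E ⊆ relativized E N := fun e he =>
  ⟨0, by simpa [Term.iterCyl] using he⟩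

/-- Relativization does not add equations whose indices are below `N`. -/
theorem mem_of_mem_relativized (hI : ClosedUnderInductiveRule E) {N : ℕ} {e : Equation ℕ}
    (hN : ∀ i ∈ e.ind, i < N) (he : e ∈ relativized E N) : e ∈ E := by
  obtain ⟨m, hm⟩ := he
  induction m with
  | zero => simpa [Term.iterCyl] using hm
  | succ m ih =>
    -- The innermost cylindrification c_{N+m} is removed by the inductive rule: the remaining
    -- equation has only indices of e, which are below N, and indices from N to N + m - 1.
    refine ih (hI _ (N + m) ?_ ?_)
    · have key : ∀ t : Term ℕ, (∀ i ∈ t.ind, i < N) →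
          N + m ∉ (t.subst fun n => Term.iterCyl N m (.var n)).ind := by
        intro t ht hmem
        rcases Term.mem_ind_subst hmem with h | ⟨n, h⟩
        · have := ht _ h; omega
        · rcases Term.ind_iterCyl h with h | h
          · omega
          · exact h
      rintro (h | h)
      · exact key e.lhs (fun i hi => hN i (Or.inl hi)) h
      · exact key e.rhs (fun i hi => hN i (Or.inr hi)) h
    · rw [Equation.cylVars, Equation.subst_subst]
      simp only [Term.subst_iterCyl]
      exact hm

theorem relativized_cyl_var (hax : ∀ e, CAAxiom e → e ∈ E) (hE : ClosedUnderEquationalLogic E)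
    {N i : ℕ} (hi : N ≤ i) (n : ℕ) : ⟨.cyl i (.var n), .var n⟩ ∈ relativized E N := by
  have hA : ∀ e, CAAxiom e → hE.isCongruence.quotient.Satisfies e := fun e he =>
    hE.isCongruence.quotient_satisfies fun σ => hE.subst σ e (hax e he)
  let := Alg.booleanAlgebra hA (hE.isCongruence.cls (.var 0))
  have hC := Alg.isCylindric hA (hE.isCongruence.cls (.var 0))
  have key : ∀ m t, hE.isCongruence.cls (Term.iterCyl N m t) =
      iterCyl hE.isCongruence.quotient.cyl N m (hE.isCongruence.cls t) := by
    intro m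
    induction m with
    | zero => exact fun _ => rfl
    | succ m ih => exact fun t => ih _
  -- With this m the block c_N … c_{N+m-1} ends in c_i and therefore absorbs the outer c_i.
  refine ⟨i - N + 1, hE.isCongruence.cls_eq_cls.1 ?_⟩
  have := hC.cyl_iterCyl hi (m := i - N + 1) (by omega) (hE.isCongruence.cls (.var n))
  rw [← key] at this
  exact this

/-- Local finiteness of the quotient: beyond N and the indices of the diagonals in t, no
cylindrification moves the class of t. -/
theorem IsCylindric.exists_cyl_fixed {hE : IsCongruence E}
    [BooleanAlgebra hE.quotient.Carrier]
    (hC : IsCylindric hE.quotient.cyl hE.quotient.diag)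
    (hadd : ∀ x y, hE.quotient.add x y = x ⊔ y) (hneg : ∀ x, hE.quotient.neg x = xᶜ) {N : ℕ}
    (hvar : ∀ i, N ≤ i → ∀ n, ⟨.cyl i (.var n), .var n⟩ ∈ E) (t : Term ℕ) :
    ∃ m, ∀ i, m ≤ i → hE.quotient.cyl i (hE.cls t) = hE.cls t := by
  induction t with
  | var n => exact ⟨N, fun i hi => hE.cls_eq_cls.2 (hvar i hi n)⟩
  | add s t hs ht =>
    obtain ⟨m, hm⟩ := hs
    obtain ⟨m', hm'⟩ := ht
    refine ⟨m + m', fun i hi => ?_⟩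
    have h1 : hE.cls (.add s t) = hE.cls s ⊔ hE.cls t := hadd (hE.cls s) (hE.cls t)
    rw [h1]
    exact hC.cyl_sup_fixed i (hm i (by omega)) (hm' i (by omega))
  | neg t ht =>
    obtain ⟨m, hm⟩ := ht
    refine ⟨m, fun i hi => ?_⟩
    have h1 : hE.cls (.neg t) = (hE.cls t)ᶜ := hneg (hE.cls t)
    rw [h1]
    exact hC.cyl_compl i (hm i hi)
  | cyl j t ht =>
    obtain ⟨m, hm⟩ := ht
    refine ⟨m, fun i hi => ?_⟩
    have h1 : hE.cls (.cyl j t) = hE.quotient.cyl j (hE.cls t) := rfl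
    rw [h1, hC.cyl_comm, hm i hi]
  | diag j k => exact ⟨j + k + 1, fun i hi => hC.cyl_diag (i := j) (j := k) (k := i) (by omega) (by omega)⟩

/-- An equation outside a theory that contains the cylindric algebra axioms and is closed under
equational logic and the inductive rule fails in the full set algebra of a countable space. -/
theorem exists_not_satisfies (hax : ∀ e, CAAxiom e → e ∈ E) (hE : ClosedUnderEquationalLogic E)
    (hI : ClosedUnderInductiveRule E) {e : Equation ℕ} (he : e ∉ E) :
    ∃ W : Set ℕ, ¬ (fullSetAlg (space ℕ W)).Satisfies e := by
  obtain ⟨N, hN⟩ : ∃ N, ∀ i ∈ e.ind, i < N := by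
    obtain ⟨N, hN⟩ := e.ind_finite.bddAbove
    exact ⟨N + 1, fun i hi => Nat.lt_succ_of_le (hN hi)⟩
  have hF := isCongruence_relativized hE N
  have hne : hF.cls e.lhs ≠ hF.cls e.rhs := fun h =>
    he (mem_of_mem_relativized hI hN (hF.cls_eq_cls.1 h))
  have hA : ∀ e, CAAxiom e → hF.quotient.Satisfies e := fun e he =>
    hF.quotient_satisfies fun σ => subset_relativized N (hE.subst σ e (hax e he))
  let := Alg.booleanAlgebra hA (hF.cls (.var 0))
  have hC := Alg.isCylindric hA (hF.cls (.var 0))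
  have hfin : ∀ x : hF.quotient.Carrier, ∃ m, ∀ i, m ≤ i → hF.quotient.cyl i x = x := by
    intro x
    obtain ⟨t, rfl⟩ := hF.cls_surjective x
    exact hC.exists_cyl_fixed (fun _ _ => rfl) (fun _ => rfl)
      (fun i hi n => relativized_cyl_var hax hE hi n) t
  have : Countable hF.quotient.Carrier := hF.cls_surjective.countable
  generalize hs : hF.cls e.lhs = s at hne
  generalize ht : hF.cls e.rhs = t at hne
  -- This is the symmetric difference of the two sides; a representation that keeps it nonempty
  -- separates them.
  have ha : (sᶜ ⊔ t)ᶜ ⊔ (tᶜ ⊔ s)ᶜ ≠ ⊥ := by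
    intro h
    rw [sup_eq_bot_iff, compl_eq_bot, compl_eq_bot] at h
    have hle : ∀ x y : hF.quotient.Carrier, xᶜ ⊔ y = ⊤ → x ≤ y := fun x y hxy => by
      have := congrArg (x ⊓ ·) hxy
      simpa [inf_sup_left] using this
    exact hne (le_antisymm (hle _ _ h.1) (hle _ _ h.2))
  obtain ⟨W, H, hsup, hcompl, hcyl, hdiag, hH⟩ := hC.exists_representation hfin N ha
  refine ⟨W, fun hsat => ?_⟩
  have heval : ∀ t : Term ℕ, (∀ i ∈ t.ind, i < N) →
      t.eval (fullSetAlg (space ℕ W)) (fun n => H (hF.cls (.var n))) = H (hF.cls t) := by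
    intro t
    induction t with
    | var n => exact fun _ => rfl
    | add s t hs ht =>
      intro h
      exact (congrArg₂ (fullSetAlg _).add (hs fun i hi => h i (Or.inl hi))
        (ht fun i hi => h i (Or.inr hi))).trans (hsup _ _).symm
    | neg t ht =>
      intro h
      exact (congrArg (fullSetAlg _).neg (ht h)).trans (hcompl _).symm
    | cyl i t ht =>
      intro h
      exact (congrArg ((fullSetAlg _).cyl i) (ht fun j hj => h j (Or.inr hj))).trans
        (hcyl i (h i (Or.inl rfl)) _).symm
    | diag i j => exact fun h => (hdiag i (h i (Or.inl rfl)) j (h j (Or.inr rfl))).symm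
  have h1 := hsat fun n => H (hF.cls (.var n))
  rw [heval _ fun i hi => hN i (Or.inl hi), heval _ fun i hi => hN i (Or.inr hi), hs, ht] at h1
  simp only [hsup, hcompl, h1, Set.compl_union_self, Set.compl_univ, Set.union_self] at hH
  exact Set.not_nonempty_empty hH

end Completeness

end CylAlg

namespace CylAlg

/-! ### Full set algebras -/

section Semantics

theorem IsHom.map_eval {α : Type u} {A B : Alg α} {f : A.Carrier → B.Carrier} (hf : IsHom A B f)
    (x : ℕ → A.Carrier) (t : Term α) : f (t.eval A x) = t.eval B fun n => f (x n) := by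
  induction t with
  | var n => rfl
  | add s t hs ht => rw [Term.eval, hf.map_add, hs, ht]; rfl
  | neg t ht => rw [Term.eval, hf.map_neg, ht]; rfl
  | cyl i t ht => rw [Term.eval, hf.map_cyl, ht]; rfl
  | diag i j => exact hf.map_diag i j

theorem mem_eqTheory_RCA_iff {α : Type u} {e : Equation α} :
    e ∈ eqTheory (RCA α) ↔ ∀ (U : Type u) (V : Set (α → U)), IsDisjointUnionOfSpaces V →
      (fullSetAlg V).Satisfies e := by
  constructor
  · intro h U V hV
    exact h _ ⟨U, V, hV, id, Function.injective_id, by constructor <;> intros <;> rfl⟩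
  · rintro h A ⟨U, V, hV, f, hf, hom⟩ x
    apply hf
    rw [hom.map_eval, hom.map_eval]
    exact h U V hV _

theorem isDisjointUnionOfSpaces_space {α U : Type u} (W : Set U) :
    IsDisjointUnionOfSpaces (space α W) :=
  ⟨{W}, Set.pairwiseDisjoint_singleton _ _, by simp⟩

theorem IsDisjointUnionOfSpaces.comp_mem {α U : Type u} {V : Set (α → U)}
    (hV : IsDisjointUnionOfSpaces V) {s : α → U} (hs : s ∈ V) (φ : α → α) : s ∘ φ ∈ V := by
  obtain ⟨K, -, rfl⟩ := hV
  simp only [Set.mem_iUnion] at hs ⊢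
  obtain ⟨W, hW, hs⟩ := hs
  exact ⟨W, hW, fun i => hs (φ i)⟩

theorem IsDisjointUnionOfSpaces.extend_mem {α U : Type u} {V : Set (α → U)}
    (hV : IsDisjointUnionOfSpaces V) {s : α → U} (hs : s ∈ V) {φ : α → α}
    (hφ : Function.Injective φ) : Function.extend φ s s ∈ V := by
  obtain ⟨K, -, rfl⟩ := hV
  simp only [Set.mem_iUnion] at hs ⊢
  obtain ⟨W, hW, hs⟩ := hs
  refine ⟨W, hW, fun i => ?_⟩
  by_cases h : ∃ j, φ j = i
  · obtain ⟨j, rfl⟩ := h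
    rw [hφ.extend_apply]
    exact hs j
  · rw [Function.extend_apply' _ _ _ h]
    exact hs i

/-- A value common to s and t yields a constant sequence lying in both of their spaces, so
disjointness makes the spaces equal and values of t may be inserted into s. -/
theorem IsDisjointUnionOfSpaces.update_mem {α U : Type u} [DecidableEq α] {V : Set (α → U)}
    (hV : IsDisjointUnionOfSpaces V) {s t : α → U} (hs : s ∈ V) (ht : t ∈ V) {k k' : α}
    (hk : s k = t k') (i j : α) : Function.update s i (t j) ∈ V := by
  obtain ⟨K, hK, rfl⟩ := hV
  simp only [Set.mem_iUnion] at hs ht ⊢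
  obtain ⟨W, hW, hs⟩ := hs
  obtain ⟨W', hW', ht⟩ := ht
  obtain rfl : W = W' := by
    by_contra hne
    exact Set.disjoint_left.1 (hK hW hW' hne) (show (fun _ => s k) ∈ space α W from fun _ => hs k)
      fun _ => hk ▸ ht k'
  refine ⟨W, hW, fun l => ?_⟩
  by_cases h : l = i
  · subst h; simpa using ht j
  · simpa [h] using hs l

/-- The value of a term in a full set algebra, as a set. -/
def Term.setEval {α : Type u} {U : Type v} {V : Set (α → U)} (X : ℕ → Set V) : Term α → Set V
  | .var n => X n
  | .add s t => s.setEval X ∪ t.setEval X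
  | .neg t => (t.setEval X)ᶜ
  | .cyl i t => {s | ∃ u ∈ t.setEval X, ∀ j, j ≠ i → s.1 j = u.1 j}
  | .diag i j => {s | s.1 i = s.1 j}

theorem Term.eval_fullSetAlg {α U : Type u} {V : Set (α → U)} (X : ℕ → Set V) (t : Term α) :
    t.eval (fullSetAlg V) X = t.setEval X := by
  induction t with
  | var n => rfl
  | add s t hs ht => exact congrArg₂ (fullSetAlg V).add hs ht
  | neg t ht => exact congrArg (fullSetAlg V).neg ht
  | cyl i t ht => exact congrArg ((fullSetAlg V).cyl i) ht
  | diag i j => rfl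

theorem satisfies_fullSetAlg_iff {α U : Type u} {V : Set (α → U)} {e : Equation α} :
    (fullSetAlg V).Satisfies e ↔ ∀ X : ℕ → Set V, e.lhs.setEval X = e.rhs.setEval X :=
  by
  have h : ∀ X : ℕ → Set V, e.lhs.eval (fullSetAlg V) X = e.rhs.eval (fullSetAlg V) X ↔
      e.lhs.setEval X = e.rhs.setEval X := fun X => by
    rw [Term.eval_fullSetAlg, Term.eval_fullSetAlg]
    exact Iff.rfl
  exact forall_congr' h

theorem Term.setEval_subst {α U : Type u} {V : Set (α → U)} (X : ℕ → Set V) (σ : ℕ → Term α)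
    (t : Term α) : (t.subst σ).setEval X = t.setEval fun n => (σ n).setEval X := by
  induction t <;> simp_all [Term.subst, Term.setEval]

/-- Pulling back along a map of units that commutes with a renaming of the indices. -/
theorem setEval_rename_preimage {α U' : Type u} {β U : Type v} (φ : β → α) {V : Set (β → U)}
    {V' : Set (α → U')} (p : V' → V)
    (hdiag : ∀ s i j, s.1 (φ i) = s.1 (φ j) ↔ (p s).1 i = (p s).1 j)
    (hforth : ∀ s t i, (∀ j, j ≠ φ i → s.1 j = t.1 j) → ∀ j, j ≠ i → (p s).1 j = (p t).1 j)
    (hback : ∀ s u i, (∀ j, j ≠ i → (p s).1 j = u.1 j) →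
      ∃ t, p t = u ∧ ∀ j, j ≠ φ i → s.1 j = t.1 j)
    (X : ℕ → Set V) (t : Term β) :
    (t.rename φ).setEval (fun n => p ⁻¹' X n) = p ⁻¹' t.setEval X := by
  induction t with
  | var n => rfl
  | add s t hs ht => rw [Term.rename, Term.setEval, hs, ht]; rfl
  | neg t ht => rw [Term.rename, Term.setEval, ht]; rfl
  | cyl i t ht =>
    rw [Term.rename, Term.setEval, ht]
    ext s
    constructor
    · rintro ⟨u, hu, hsu⟩
      exact ⟨p u, hu, hforth s u i hsu⟩
    · rintro ⟨u, hu, hsu⟩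
      obtain ⟨v, rfl, hsv⟩ := hback s u i hsu
      exact ⟨v, hu, hsv⟩
  | diag i j =>
    ext s
    exact hdiag s i j

theorem Term.rename_eq_self {α : Type u} {φ : α → α} {t : Term α} (h : ∀ i ∈ t.ind, φ i = i) :
    t.rename φ = t := by
  induction t <;> simp_all [Term.rename, Term.ind]

theorem Equation.rename_eq_self {α : Type u} {φ : α → α} {e : Equation α}
    (h : ∀ i ∈ e.ind, φ i = i) : e.rename φ = e := by
  rw [Equation.rename, Term.rename_eq_self fun i hi => h i (Or.inl hi),
    Term.rename_eq_self fun i hi => h i (Or.inr hi)]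

theorem Term.rename_rename {α β γ : Type*} (φ : α → β) (ψ : β → γ) (t : Term α) :
    (t.rename φ).rename ψ = t.rename (ψ ∘ φ) := by
  induction t <;> simp_all [Term.rename]

/-- An infinite set has an injective self-map that fixes a given finite set and avoids a given
point outside it. -/
theorem exists_injective_fixing {α : Type*} [Infinite α] {S : Set α} (hS : S.Finite) {i : α}
    (hi : i ∉ S) :
    ∃ φ : α → α, Function.Injective φ ∧ (∀ j ∈ S, φ j = j) ∧ ∀ j, φ j ≠ i := by
  classical
  have hinf : (insert i S)ᶜ.Infinite := (hS.insert i).infinite_compl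
  let g' := hinf.natEmbedding
  -- A sequence of distinct points outside S starting at i. The map φ shifts it by one place and is
  -- the identity elsewhere, which vacates i.
  let g : ℕ → α := fun n => match n with
    | 0 => i
    | m + 1 => (g' m).1
  have hg' : ∀ m, (g' m).1 ≠ i ∧ (g' m).1 ∉ S := fun m => by
    have h : (g' m).1 ∉ insert i S := (g' m).2
    exact ⟨fun h' => h (Or.inl h'), fun h' => h (Or.inr h')⟩
  have hg : Function.Injective g := by
    rintro (_ | m) (_ | n) h
    · rfl
    · exact absurd h.symm (hg' n).1
    · exact absurd h (hg' m).1
    · rw [g'.injective (Subtype.ext h)]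
  have hgS : ∀ n, g n ∉ S := by
    rintro (_ | m)
    · exact hi
    · exact (hg' m).2
  have hon : ∀ n, Function.extend g (fun n => g (n + 1)) id (g n) = g (n + 1) := fun n =>
    hg.extend_apply _ _ n
  have hoff : ∀ a, (¬ ∃ n, g n = a) → Function.extend g (fun n => g (n + 1)) id a = a := fun a ha =>
    Function.extend_apply' _ _ _ ha
  refine ⟨Function.extend g (fun n => g (n + 1)) id, fun a b hab => ?_, fun j hj => ?_,
    fun j hj => ?_⟩
  · by_cases ha : ∃ n, g n = a <;> by_cases hb : ∃ n, g n = b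
    · obtain ⟨m, rfl⟩ := ha
      obtain ⟨n, rfl⟩ := hb
      rw [hon, hon] at hab
      rw [Nat.succ_injective (hg hab)]
    · obtain ⟨m, rfl⟩ := ha
      rw [hon, hoff b hb] at hab
      exact absurd ⟨m + 1, hab⟩ hb
    · obtain ⟨n, rfl⟩ := hb
      rw [hon, hoff a ha] at hab
      exact absurd ⟨n + 1, hab.symm⟩ ha
    · rwa [hoff a ha, hoff b hb] at hab
  · refine hoff j ?_
    rintro ⟨n, rfl⟩
    exact hgS n hj
  · by_cases h : ∃ n, g n = j
    · obtain ⟨n, rfl⟩ := h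
      rw [hon] at hj
      exact absurd (hg (a₁ := n + 1) (a₂ := 0) hj) (Nat.succ_ne_zero n)
    · rw [hoff j h] at hj
      exact h ⟨0, hj.symm⟩

/-! ### Soundness of the rules and axioms -/

theorem closedUnderInductiveRule_eqTheory_RCA (α : Type u) [Infinite α] :
    ClosedUnderInductiveRule (eqTheory (RCA α)) := by
  classical
  intro e i hi he
  rw [mem_eqTheory_RCA_iff] at he ⊢
  intro U V hV
  rw [satisfies_fullSetAlg_iff]
  intro X
  obtain ⟨φ, hφ, hfix, hav⟩ := exists_injective_fixing e.ind_finite hi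
  let p : V → V := fun s => ⟨s.1 ∘ φ, hV.comp_mem s.2 φ⟩
  have hp : Function.Surjective p := fun u =>
    ⟨⟨_, hV.extend_mem u.2 hφ⟩, Subtype.ext (funext fun j => hφ.extend_apply _ _ j)⟩
  have key := setEval_rename_preimage φ p (fun _ _ _ => Iff.rfl)
    (fun s t i h j hj => h (φ j) fun h' => hj (hφ h')) (by
      intro s u i h
      -- The agreement of s ∘ φ and u at some k ≠ i places s and u in the same space, so the value u
      -- i may be written into s at φ i.
      obtain ⟨k, hk⟩ := exists_ne i
      refine ⟨⟨Function.update s.1 (φ i) (u.1 i), hV.update_mem s.2 u.2 (h k hk) _ _⟩,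
        Subtype.ext (funext fun j => ?_), fun j hj => ?_⟩
      · by_cases hj : j = i
        · subst hj; simp [p]
        · have := h j hj
          simpa [p, hφ.ne hj] using this
      · simp [hj]) X
  -- Membership in a preimage depends only on coordinates in the range of φ, which omits i.
  have hcyl : ∀ n, (Term.cyl i (.var n)).setEval (fun n => p ⁻¹' X n) = p ⁻¹' X n := by
    intro n
    ext s
    constructor
    · rintro ⟨t, ht, hst⟩
      have : p s = p t := Subtype.ext (funext fun j => hst _ (hav j))
      rwa [Set.mem_preimage, this]
    · exact fun hs => ⟨s, hs, fun _ _ => rfl⟩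
  have h1 := satisfies_fullSetAlg_iff.1 (he U V hV) fun n => p ⁻¹' X n
  simp only [Equation.cylVars, Equation.subst, Term.setEval_subst, hcyl] at h1
  rw [← Equation.rename_eq_self hfix] at h1
  simp only [Equation.rename, key] at h1
  exact hp.preimage_injective h1

theorem closedUnderEquationalLogic_eqTheory {α : Type u} (K : Set (Alg α)) :
    ClosedUnderEquationalLogic (eqTheory K) where
  refl _ _ _ _ := rfl
  symm _ _ h A hA x := (h A hA x).symm
  trans _ _ _ h h' A hA x := (h A hA x).trans (h' A hA x)
  congr_add _ _ _ _ h h' A hA x := congrArg₂ A.add (h A hA x) (h' A hA x)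
  congr_neg _ _ h A hA x := congrArg A.neg (h A hA x)
  congr_cyl i _ _ h A hA x := congrArg (A.cyl i) (h A hA x)
  subst σ e h A hA x := by
    simp only [Equation.subst, Term.eval_subst]
    exact h A hA _

/-- The outer points s and t agree at a third index k ≠ i, j, hence lie in one space. This keeps the
intermediate point with the two changes made in the other order inside V. -/
theorem IsDisjointUnionOfSpaces.cyl_comm_subset {α U : Type u} [Infinite α] {V : Set (α → U)}
    (hV : IsDisjointUnionOfSpaces V) (i j : α) (X : ℕ → Set V) (t : Term α) :
    (Term.cyl i (.cyl j t)).setEval X ⊆ (Term.cyl j (.cyl i t)).setEval X := by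
  classical
  rintro s ⟨u, ⟨t, ht, hut⟩, hsu⟩
  obtain ⟨k, hk⟩ := Infinite.exists_notMem_finset {i, j}
  simp only [Finset.mem_insert, Finset.mem_singleton, not_or] at hk
  refine ⟨⟨_, hV.update_mem s.2 t.2 ((hsu k hk.1).trans (hut k hk.2)) j j⟩, ⟨t, ht, ?_⟩, ?_⟩
  · intro l hl
    by_cases hlj : l = j
    · subst hlj; simp
    · simpa [hlj] using (hsu l hl).trans (hut l hlj)
  · intro l hl
    simp [hl]

theorem IsDisjointUnionOfSpaces.satisfies_of_CAAxiom {α U : Type u} [Infinite α]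
    {V : Set (α → U)} (hV : IsDisjointUnionOfSpaces V) {e : Equation α} (he : CAAxiom e) :
    (fullSetAlg V).Satisfies e := by
  classical
  rw [satisfies_fullSetAlg_iff]
  intro X
  have hmul : ∀ s t : Term α, (s.mul t).setEval X = s.setEval X ∩ t.setEval X := fun s t => by
    simp [Term.mul, Term.setEval, Set.compl_union]
  have hone : Term.one.setEval X = Set.univ := by simp [Term.one, Term.setEval]
  have hzero : Term.zero.setEval X = ∅ := by rw [Term.zero, Term.setEval, hone, Set.compl_univ]
  induction he with
  | c1 i =>
    simp only [hzero]
    simp [Term.setEval, hzero]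
  | c2 i => exact Set.union_eq_right.2 fun s hs => ⟨s, hs, fun _ _ => rfl⟩
  | c3 i =>
    simp only [hmul]
    ext s
    constructor
    · rintro ⟨t, ht, hst⟩
      rw [hmul] at ht
      obtain ⟨ht, u, hu, htu⟩ := ht
      exact ⟨⟨t, ht, hst⟩, u, hu, fun j hj => (hst j hj).trans (htu j hj)⟩
    · rintro ⟨⟨t, ht, hst⟩, u, hu, hsu⟩
      refine ⟨t, ?_, hst⟩
      rw [hmul]
      exact ⟨ht, u, hu, fun j hj => (hst j hj).symm.trans (hsu j hj)⟩
  | c4 i j => exact (hV.cyl_comm_subset i j _ _).antisymm (hV.cyl_comm_subset j i _ _)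
  | c5 i =>
    rw [hone]
    exact Set.eq_univ_of_forall fun s => rfl
  | c6 i j k hi hj =>
    ext s
    constructor
    · intro hs
      have hs' : s.1 i = s.1 j := hs
      refine ⟨⟨_, hV.update_mem s.2 s.2 (k := i) rfl k i⟩, ?_, fun l hl => ?_⟩
      · rw [hmul]
        constructor
        · change Function.update s.1 k (s.1 i) i = Function.update s.1 k (s.1 i) k
          simp [hi.symm]
        · change Function.update s.1 k (s.1 i) k = Function.update s.1 k (s.1 i) j
          simp [hj.symm, hs']
      · simp [hl]
    · rintro ⟨t, ht, hst⟩
      rw [hmul] at ht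
      change s.1 i = s.1 j
      rw [hst i hi.symm, hst j hj.symm]
      exact Eq.trans ht.1 ht.2
  | c7 i j hij =>
    rw [hmul, hzero]
    refine Set.eq_empty_of_forall_notMem ?_
    rintro s ⟨⟨t, ht, hst⟩, u, hu, hsu⟩
    rw [hmul] at ht hu
    have h1 : t.1 i = t.1 j := ht.1
    have h2 : u.1 i = u.1 j := hu.1
    have : t = u := by
      ext l
      by_cases hl : l = i
      · rw [hl, h1, h2, ← hst j hij.symm, ← hsu j hij.symm]
      · rw [← hst l hl, ← hsu l hl]
    exact hu.2 (this ▸ ht.2)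
  | _ =>
    ext s
    simp only [hmul, Term.setEval, Set.mem_union, Set.mem_inter_iff, Set.mem_compl_iff]
    tauto

theorem mem_eqTheory_RCA_of_CAAxiom {α : Type u} [Infinite α] {e : Equation α} (he : CAAxiom e) :
    e ∈ eqTheory (RCA α) :=
  mem_eqTheory_RCA_iff.2 fun _ _ hV => hV.satisfies_of_CAAxiom he

/-- A countermodel over the index set `ℕ` gives one over a larger index set. -/
theorem rename_notMem_eqTheory_RCA {α : Type u} {ρ : ℕ → α} (hρ : Function.Injective ρ)
    {W : Set ℕ} {e : Equation ℕ} (he : ¬ (fullSetAlg (space ℕ W)).Satisfies e) :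
    e.rename ρ ∉ eqTheory (RCA α) := by
  classical
  intro h
  rw [mem_eqTheory_RCA_iff] at h
  refine he (satisfies_fullSetAlg_iff.2 fun X => ?_)
  -- Restriction along ρ; `ULift` only moves the base W into the universe of α.
  let p : space α (ULift.down.{u} ⁻¹' W) → space ℕ W := fun s =>
    ⟨fun i => (s.1 (ρ i)).down, fun i => s.2 (ρ i)⟩
  have hp : Function.Surjective p := by
    intro u
    refine ⟨⟨Function.extend ρ (fun i => ULift.up (u.1 i)) fun _ => ULift.up (u.1 0), fun i => ?_⟩,
      Subtype.ext (funext fun i => ?_)⟩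
    · by_cases hi : ∃ n, ρ n = i
      · obtain ⟨n, rfl⟩ := hi
        rw [hρ.extend_apply]
        exact u.2 n
      · rw [Function.extend_apply' _ _ _ hi]
        exact u.2 0
    · simp [p, hρ.extend_apply]
  have key := setEval_rename_preimage ρ p
    (fun s i j => ⟨fun h => congrArg ULift.down h, fun h => ULift.down_injective h⟩)
    (fun s t i h j hj => congrArg ULift.down (h (ρ j) fun h' => hj (hρ h'))) (by
      intro s u i h
      refine ⟨⟨Function.update s.1 (ρ i) (ULift.up (u.1 i)), fun j => ?_⟩,
        Subtype.ext (funext fun j => ?_), fun j hj => ?_⟩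
      · by_cases hj : j = ρ i
        · subst hj
          simpa using u.2 i
        · simpa [hj] using s.2 j
      · by_cases hj : j = i
        · subst hj; simp [p]
        · have := h j hj
          simpa [p, hρ.ne hj] using this
      · simp [hj]) X
  have h1 := satisfies_fullSetAlg_iff.1 (h _ _ (isDisjointUnionOfSpaces_space _))
    fun n => p ⁻¹' X n
  simp only [Equation.rename, key] at h1
  exact hp.preimage_injective h1

end Semantics

/-! ### Renaming the indices of theories -/

section Renaming

variable {α : Type u}

theorem Term.rename_subst {β : Type*} (ρ : β → α) (σ : ℕ → Term β) (t : Term β) :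
    (t.subst σ).rename ρ = (t.rename ρ).subst fun n => (σ n).rename ρ := by
  induction t <;> simp_all [Term.subst, Term.rename]

theorem Term.ind_rename {β : Type*} (ρ : β → α) (t : Term β) :
    (t.rename ρ).ind = ρ '' t.ind := by
  induction t <;> simp_all [Term.rename, Term.ind, Set.image_union, Set.image_insert_eq]

theorem CAAxiom.rename {β : Type*} {ρ : β → α} (hρ : Function.Injective ρ) {e : Equation β}
    (he : CAAxiom e) : CAAxiom (e.rename ρ) := by
  induction he with
  | c6 i j k hi hj => exact .c6 _ _ _ (hρ.ne hi) (hρ.ne hj)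
  | c7 i j h => exact .c7 _ _ (hρ.ne h)
  | _ => constructor

/-- The theories that are closed under the axioms and rules of the inductive calculus. -/
structure IsInductiveTheory (E : Set (Equation α)) : Prop where
  ax : ∀ e, CAAxiom e → e ∈ E
  logic : ClosedUnderEquationalLogic E
  inductive_rule : ClosedUnderInductiveRule E

/-- Injectivity of ρ preserves the side conditions of (C₆), (C₇) and the inductive rule. -/
theorem IsInductiveTheory.preimage_rename {β : Type*} {E : Set (Equation α)}
    (hE : IsInductiveTheory E) {ρ : β → α} (hρ : Function.Injective ρ) :
    IsInductiveTheory {e : Equation β | e.rename ρ ∈ E} where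
  ax e he := hE.ax _ (he.rename hρ)
  logic :=
    { refl := fun _ => hE.logic.refl _
      symm := fun _ _ h => hE.logic.symm _ _ h
      trans := fun _ _ _ h h' => hE.logic.trans _ _ _ h h'
      congr_add := fun _ _ _ _ h h' => hE.logic.congr_add _ _ _ _ h h'
      congr_neg := fun _ _ h => hE.logic.congr_neg _ _ h
      congr_cyl := fun i _ _ h => hE.logic.congr_cyl (ρ i) _ _ h
      subst := fun σ e h => by
        have := hE.logic.subst (fun n => (σ n).rename ρ) _ h
        simpa only [Equation.rename, Equation.subst, Term.rename_subst, Set.mem_ofPred_eq]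
          using this }
  inductive_rule e i hi h := by
    refine hE.inductive_rule _ (ρ i) ?_ ?_
    · simp only [Equation.ind, Equation.rename, Term.ind_rename, ← Set.image_union]
      rw [hρ.mem_set_image]
      exact hi
    · simpa only [Equation.cylVars, Equation.rename, Equation.subst, Term.rename_subst,
        Set.mem_ofPred_eq, Term.rename] using h

theorem isInductiveTheory_eqTheory_RCA (α : Type u) [Infinite α] :
    IsInductiveTheory (eqTheory (RCA α)) :=
  ⟨fun _ he => mem_eqTheory_RCA_of_CAAxiom he, closedUnderEquationalLogic_eqTheory _,
    closedUnderInductiveRule_eqTheory_RCA α⟩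

theorem exists_injective_nat_range {α : Type*} [Infinite α] {S : Set α} (hS : S.Finite) :
    ∃ ρ : ℕ → α, Function.Injective ρ ∧ S ⊆ Set.range ρ := by
  let g := Infinite.natEmbedding α
  have h1 : (S ∪ Set.range g).Countable := hS.countable.union (Set.countable_range g)
  have h2 : (S ∪ Set.range g).Infinite :=
    (Set.infinite_range_of_injective g.injective).mono Set.subset_union_right
  have := h1.to_subtype
  have := h2.to_subtype
  obtain ⟨f⟩ := nonempty_equiv_of_countable (α := ℕ) (β := (S ∪ Set.range g : Set α))
  refine ⟨fun n => (f n).1, Subtype.val_injective.comp f.injective, fun a ha => ?_⟩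
  exact ⟨f.symm ⟨a, Or.inl ha⟩, by simp⟩

theorem exists_rename_eq [Infinite α] (e : Equation α) :
    ∃ (ρ : ℕ → α) (e' : Equation ℕ), Function.Injective ρ ∧ e'.rename ρ = e := by
  obtain ⟨ρ, hρ, hS⟩ := exists_injective_nat_range e.ind_finite
  refine ⟨ρ, e.rename (Function.invFun ρ), hρ, ?_⟩
  have : (e.rename (Function.invFun ρ)).rename ρ = e.rename (ρ ∘ Function.invFun ρ) := by
    simp [Equation.rename, Term.rename_rename]
  rw [this]
  exact Equation.rename_eq_self fun i hi => Function.invFun_eq (hS hi)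

theorem IsInductiveTheory.eqTheory_RCA_subset [Infinite α] {E : Set (Equation α)}
    (hE : IsInductiveTheory E) : eqTheory (RCA α) ⊆ E := by
  intro e he
  obtain ⟨ρ, e, hρ, rfl⟩ := exists_rename_eq e
  by_contra hne
  have h := hE.preimage_rename hρ
  obtain ⟨W, hW⟩ := exists_not_satisfies h.ax h.logic h.inductive_rule hne
  exact rename_notMem_eqTheory_RCA hρ hW he

/-! ### The calculus over ℕ -/

/-- Derivability in the inductive calculus over the index set `ℕ`. -/
inductive Derivable : Equation ℕ → Prop where
  | ax (e : Equation ℕ) : CAAxiom e → Derivable e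
  | refl (t : Term ℕ) : Derivable ⟨t, t⟩
  | symm (s t : Term ℕ) : Derivable ⟨s, t⟩ → Derivable ⟨t, s⟩
  | trans (r s t : Term ℕ) : Derivable ⟨r, s⟩ → Derivable ⟨s, t⟩ → Derivable ⟨r, t⟩
  | congr_add (s s' t t' : Term ℕ) : Derivable ⟨s, s'⟩ → Derivable ⟨t, t'⟩ →
      Derivable ⟨.add s t, .add s' t'⟩
  | congr_neg (t t' : Term ℕ) : Derivable ⟨t, t'⟩ → Derivable ⟨.neg t, .neg t'⟩
  | congr_cyl (i : ℕ) (t t' : Term ℕ) : Derivable ⟨t, t'⟩ → Derivable ⟨.cyl i t, .cyl i t'⟩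
  | subst (σ : ℕ → Term ℕ) (e : Equation ℕ) : Derivable e → Derivable (e.subst σ)
  | inductive_rule (e : Equation ℕ) (i : ℕ) : i ∉ e.ind → Derivable (e.cylVars i) → Derivable e

theorem isInductiveTheory_derivable : IsInductiveTheory {e | Derivable e} :=
  ⟨.ax, ⟨.refl, .symm, .trans, .congr_add, .congr_neg, .congr_cyl, .subst⟩, .inductive_rule⟩

theorem Derivable.mem {E : Set (Equation ℕ)} (hE : IsInductiveTheory E) {e : Equation ℕ}
    (he : Derivable e) : e ∈ E := by
  induction he with
  | ax e he => exact hE.ax e he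
  | refl t => exact hE.logic.refl t
  | symm s t _ h => exact hE.logic.symm _ _ h
  | trans r s t _ _ h h' => exact hE.logic.trans _ _ _ h h'
  | congr_add s s' t t' _ _ h h' => exact hE.logic.congr_add _ _ _ _ h h'
  | congr_neg t t' _ h => exact hE.logic.congr_neg _ _ h
  | congr_cyl i t t' _ h => exact hE.logic.congr_cyl i _ _ h
  | subst σ e _ h => exact hE.logic.subst σ e h
  | inductive_rule e i hi _ h => exact hE.inductive_rule e i hi h

/-- The left side does not mention ρ or α, so a single enumeration over ℕ serves every injection.
Soundness gives one direction, the countermodel the other. -/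
theorem derivable_iff_rename_mem [Infinite α] {ρ : ℕ → α} (hρ : Function.Injective ρ)
    (e : Equation ℕ) : Derivable e ↔ e.rename ρ ∈ eqTheory (RCA α) := by
  refine ⟨fun h => h.mem ((isInductiveTheory_eqTheory_RCA α).preimage_rename hρ), fun h => ?_⟩
  by_contra hne
  have hD := isInductiveTheory_derivable
  obtain ⟨W, hW⟩ := exists_not_satisfies hD.ax hD.logic hD.inductive_rule hne
  exact rename_notMem_eqTheory_RCA hρ hW h

end Renaming

end CylAlg

namespace CylAlg

/-! ### Primitive recursive functions of codes -/

namespace Term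

/-- Recursion on terms. -/
def fold {σ : Type*} (v : ℕ → σ) (a : σ → σ → σ) (g : σ → σ) (c : ℕ → σ → σ) (d : ℕ → ℕ → σ) :
    Term ℕ → σ
  | .var n => v n
  | .add s t => a (s.fold v a g c d) (t.fold v a g c d)
  | .neg t => g (t.fold v a g c d)
  | .cyl i t => c i (t.fold v a g c d)
  | .diag i j => d i j

theorem primrec_fold_decode {P σ : Type*} [Primcodable P] [Primcodable σ] [Inhabited σ]
    {v : P → ℕ → σ} {a : P → σ → σ → σ} {g : P → σ → σ} {c : P → ℕ → σ → σ} {d : P → ℕ → ℕ → σ}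
    (hv : Primrec₂ v) (ha : Primrec fun q : P × σ × σ => a q.1 q.2.1 q.2.2) (hg : Primrec₂ g)
    (hc : Primrec fun q : P × ℕ × σ => c q.1 q.2.1 q.2.2)
    (hd : Primrec fun q : P × ℕ × ℕ => d q.1 q.2.1 q.2.2) :
    Primrec₂ fun p n => (decode n).fold (v p) (a p) (g p) (c p) (d p) := by
  -- Course-of-values recursion: l lists the values at all numbers below n, so its length is n, and
  -- the codes of the subterms are positions in l.
  let F : P → List σ → σ := fun p l =>
    if l.length.unpair.1 = 0 then v p l.length.unpair.2
    else if l.length.unpair.1 = 1 then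
      a p (l.getD l.length.unpair.2.unpair.1 default) (l.getD l.length.unpair.2.unpair.2 default)
    else if l.length.unpair.1 = 2 then g p (l.getD l.length.unpair.2 default)
    else if l.length.unpair.1 = 3 then
      c p l.length.unpair.2.unpair.1 (l.getD l.length.unpair.2.unpair.2 default)
    else d p l.length.unpair.2.unpair.1 l.length.unpair.2.unpair.2
  have hlen : Primrec fun q : P × List σ => q.2.length.unpair :=
    Primrec.unpair.comp (Primrec.list_length.comp Primrec.snd)
  have htag : Primrec fun q : P × List σ => q.2.length.unpair.1 := Primrec.fst.comp hlen
  have hr : Primrec fun q : P × List σ => q.2.length.unpair.2 := Primrec.snd.comp hlen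
  have hr1 : Primrec fun q : P × List σ => q.2.length.unpair.2.unpair.1 :=
    Primrec.fst.comp (Primrec.unpair.comp hr)
  have hr2 : Primrec fun q : P × List σ => q.2.length.unpair.2.unpair.2 :=
    Primrec.snd.comp (Primrec.unpair.comp hr)
  have hget : ∀ {f : P × List σ → ℕ}, Primrec f →
      Primrec fun q : P × List σ => q.2.getD (f q) default :=
    fun hf => (Primrec.list_getD default).comp Primrec.snd hf
  have heq : ∀ k : ℕ, PrimrecPred fun q : P × List σ => q.2.length.unpair.1 = k := fun k =>
    Primrec.eq.comp htag (Primrec.const k)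
  have hF : Primrec₂ F :=
    Primrec.ite (heq 0) (hv.comp Primrec.fst hr) <|
    Primrec.ite (heq 1) (ha.comp (Primrec.fst.pair ((hget hr1).pair (hget hr2)))) <|
    Primrec.ite (heq 2) (hg.comp Primrec.fst (hget hr)) <|
    Primrec.ite (heq 3) (hc.comp (Primrec.fst.pair (hr1.pair (hget hr2)))) <|
    hd.comp (Primrec.fst.pair (hr1.pair hr2))
  refine Primrec.nat_strong_rec _ (g := fun p l => some (F p l))
    (Primrec.option_some.comp hF) fun p n => congrArg some ?_
  have hget : ∀ (f : ℕ → σ) {m}, m < n → ((List.range n).map f).getD m default = f m := by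
    intro f m hm
    simp [List.getD, List.getElem?_range hm]
  simp only [F, List.length_map, List.length_range]
  rw [decode]
  by_cases h0 : n.unpair.1 = 0
  · simp [h0, fold]
  have h1 := unpair_snd_lt h0
  have h2 := (Nat.unpair_left_le n.unpair.2).trans_lt h1
  have h3 := (Nat.unpair_right_le n.unpair.2).trans_lt h1
  rw [if_neg h0, dif_neg h0, hget _ h1, hget _ h2, hget _ h3]
  split_ifs <;> rfl

theorem primrec_code_subst_decode {P : Type*} [Primcodable P] {σ : P → ℕ → Term ℕ}
    (hσ : Primrec₂ fun p n => (σ p n).code) :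
    Primrec₂ fun (p : P) n => ((decode n).subst (σ p)).code := by
  have hpair : ∀ k : ℕ, Primrec fun n => Nat.pair k n := fun k =>
    Primrec₂.natPair.comp (Primrec.const k) Primrec.id
  refine (primrec_fold_decode (a := fun _ x y => Nat.pair 1 (Nat.pair x y))
    (g := fun _ x => Nat.pair 2 x) (c := fun _ i x => Nat.pair 3 (Nat.pair i x))
    (d := fun _ i j => Nat.pair 4 (Nat.pair i j)) hσ
    ((hpair 1).comp (Primrec₂.natPair.comp (Primrec.fst.comp Primrec.snd)
      (Primrec.snd.comp Primrec.snd)))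
    ((hpair 2).comp Primrec.snd)
    ((hpair 3).comp (Primrec₂.natPair.comp (Primrec.fst.comp Primrec.snd)
      (Primrec.snd.comp Primrec.snd)))
    ((hpair 4).comp (Primrec₂.natPair.comp (Primrec.fst.comp Primrec.snd)
      (Primrec.snd.comp Primrec.snd)))).of_eq fun p n => ?_
  generalize decode n = t
  induction t <;> simp_all [fold, subst, code]

theorem primrec_code_decode : Primrec fun n => (decode n).code := by
  have h : Primrec₂ fun (_ : Unit) n => ((decode n).subst var).code :=
    primrec_code_subst_decode (Primrec₂.natPair.comp (Primrec.const 0) Primrec.snd)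
  simpa using h.comp (Primrec.const ()) Primrec.id

theorem primrecRel_mem_ind_decode : PrimrecRel fun (i n : ℕ) => i ∈ (decode n).ind := by
  classical
  have hor : Primrec fun q : Bool × Bool => q.1 || q.2 := Primrec.or
  have hbeq : Primrec₂ fun i j : ℕ => i == j := Primrec.beq
  have h : Primrec₂ fun (i n : ℕ) => (decode n).fold (fun _ => false) (fun x y => x || y) id
      (fun j x => i == j || x) fun j k => i == j || i == k :=
    primrec_fold_decode (P := ℕ) (v := fun _ _ => false) (a := fun _ x y => x || y)
      (g := fun _ => id) (c := fun i j x => i == j || x) (d := fun i j k => i == j || i == k)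
      (Primrec.const false) (hor.comp Primrec.snd) Primrec.snd
      (hor.comp ((hbeq.comp Primrec.fst (Primrec.fst.comp Primrec.snd)).pair
        (Primrec.snd.comp Primrec.snd)))
      (hor.comp ((hbeq.comp Primrec.fst (Primrec.fst.comp Primrec.snd)).pair
        (hbeq.comp Primrec.fst (Primrec.snd.comp Primrec.snd))))
  refine PrimrecRel.of_eq (r := fun i n => (decode n).fold (fun _ => false) (fun x y => x || y) id
      (fun j x => i == j || x) (fun j k => i == j || i == k) = true)
    (Primrec.eq.comp h (Primrec.const true)) fun i n => ?_
  generalize decode n = t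
  induction t <;> simp_all [fold, ind]

/-- Only finitely many values of a substitution matter, so in the enumeration a substitution can be
given by a finite list. -/
theorem exists_subst_congr (t : Term ℕ) :
    ∃ N, ∀ σ τ : ℕ → Term ℕ, (∀ n < N, σ n = τ n) → t.subst σ = t.subst τ := by
  induction t with
  | var n => exact ⟨n + 1, fun σ τ h => h n (by omega)⟩
  | add s t hs ht =>
    obtain ⟨m, hm⟩ := hs
    obtain ⟨n, hn⟩ := ht
    refine ⟨m + n, fun σ τ h => ?_⟩
    rw [subst, hm σ τ fun k hk => h k (by omega), hn σ τ fun k hk => h k (by omega)]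
    rfl
  | neg t ht =>
    obtain ⟨n, hn⟩ := ht
    exact ⟨n, fun σ τ h => congrArg neg (hn σ τ h)⟩
  | cyl i t ht =>
    obtain ⟨n, hn⟩ := ht
    exact ⟨n, fun σ τ h => congrArg (cyl i) (hn σ τ h)⟩
  | diag i j => exact ⟨0, fun _ _ _ => rfl⟩

end Term

/-! ### Recursive enumeration of the derivable equations -/

/-- The equation with a given code. -/
def Equation.decode (n : ℕ) : Equation ℕ := ⟨Term.decode n.unpair.1, Term.decode n.unpair.2⟩

@[simp] theorem Equation.decode_code (e : Equation ℕ) : Equation.decode e.code = e := by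
  simp [Equation.decode, Equation.code]

open Term in
/-- All instances of the axioms with indices `i`, `j`, `k`. -/
def axiomInstances (i j k : ℕ) : List (Equation ℕ) :=
  [⟨add (var 0) (var 1), add (var 1) (var 0)⟩,
    ⟨mul (var 0) (var 1), mul (var 1) (var 0)⟩,
    ⟨add (add (var 0) (var 1)) (var 2), add (var 0) (add (var 1) (var 2))⟩,
    ⟨mul (mul (var 0) (var 1)) (var 2), mul (var 0) (mul (var 1) (var 2))⟩,
    ⟨add (var 0) (mul (var 0) (var 1)), var 0⟩,
    ⟨mul (var 0) (add (var 0) (var 1)), var 0⟩,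
    ⟨mul (var 0) (add (var 1) (var 2)), add (mul (var 0) (var 1)) (mul (var 0) (var 2))⟩,
    ⟨add (var 0) (mul (var 1) (var 2)), mul (add (var 0) (var 1)) (add (var 0) (var 2))⟩,
    ⟨add (var 0) (mul (var 1) (neg (var 1))), var 0⟩,
    ⟨mul (var 0) (add (var 1) (neg (var 1))), var 0⟩,
    ⟨cyl i zero, zero⟩,
    ⟨add (var 0) (cyl i (var 0)), cyl i (var 0)⟩,
    ⟨cyl i (mul (var 0) (cyl i (var 1))), mul (cyl i (var 0)) (cyl i (var 1))⟩,
    ⟨cyl i (cyl j (var 0)), cyl j (cyl i (var 0))⟩,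
    ⟨diag i i, one⟩,
    -- When a side condition fails, a trivial identity fills the place, so the list keeps its shape
    -- for all i, j, k.
    if k = i ∨ k = j then ⟨var 0, var 0⟩ else ⟨diag i j, cyl k (mul (diag i k) (diag k j))⟩,
    if i = j then ⟨var 0, var 0⟩ else
      ⟨mul (cyl i (mul (diag i j) (var 0))) (cyl i (mul (diag i j) (neg (var 0)))), zero⟩]

theorem derivable_of_mem_axiomInstances {i j k : ℕ} {e : Equation ℕ}
    (he : e ∈ axiomInstances i j k) : Derivable e := by
  simp only [axiomInstances, List.mem_cons, List.not_mem_nil, or_false] at he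
  rcases he with rfl | rfl | rfl | rfl | rfl | rfl | rfl | rfl | rfl | rfl | rfl | rfl | rfl | rfl |
    rfl | he | he
  on_goal 16 =>
    split_ifs at he with h
    · exact he ▸ .refl _
    · push Not at h
      exact he ▸ .ax _ (.c6 i j k h.1 h.2)
  on_goal 16 =>
    split_ifs at he with h
    · exact he ▸ .refl _
    · exact he ▸ .ax _ (.c7 i j h)
  all_goals exact .ax _ (by constructor)

theorem CAAxiom.exists_mem_axiomInstances {e : Equation ℕ} (he : CAAxiom e) :
    ∃ i j k, e ∈ axiomInstances i j k := by
  cases he with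
  | c1 i => exact ⟨i, i, i, by simp [axiomInstances]⟩
  | c2 i => exact ⟨i, i, i, by simp [axiomInstances]⟩
  | c3 i => exact ⟨i, i, i, by simp [axiomInstances]⟩
  | c4 i j => exact ⟨i, j, i, by simp [axiomInstances]⟩
  | c5 i => exact ⟨i, i, i, by simp [axiomInstances]⟩
  | c6 i j k hi hj => exact ⟨i, j, k, by simp [axiomInstances, hi, hj]⟩
  | c7 i j h => exact ⟨i, j, i, by simp [axiomInstances, h]⟩
  | _ => exact ⟨0, 0, 0, by simp [axiomInstances]⟩

/-- The codes of the equations that one rule, or one axiom, with the parameter `b` yields from a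
list `l` of codes. -/
noncomputable def candidates (l : List ℕ) (b : ℕ) : List ℕ :=
  open Classical in
  let x := b.unpair.1
  let y := b.unpair.2
  let p := (l.getD b 0).unpair
  let q := (l.getD x 0).unpair
  let r := (l.getD y 0).unpair
  [Nat.pair b b,
    Nat.pair p.2 p.1,
    -- The default 0 codes the identity x₀ = x₀, so an inapplicable rule lists nothing underivable;
    -- the same holds for positions outside l.
    if q.2 = r.1 then Nat.pair q.1 r.2 else 0,
    Nat.pair (Nat.pair 1 (Nat.pair q.1 r.1)) (Nat.pair 1 (Nat.pair q.2 r.2)),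
    Nat.pair (Nat.pair 2 p.1) (Nat.pair 2 p.2),
    Nat.pair (Nat.pair 3 (Nat.pair x r.1)) (Nat.pair 3 (Nat.pair x r.2)),
    ((Equation.decode (l.getD y 0)).subst fun n =>
      Term.decode ((Denumerable.ofNat (List ℕ) x).getD n 0)).code,
    if x.unpair.1 ∉ (Equation.decode x.unpair.2).ind ∧
      l.getD y 0 = ((Equation.decode x.unpair.2).cylVars x.unpair.1).code
    then x.unpair.2 else 0] ++
  (axiomInstances x y.unpair.1 y.unpair.2).map Equation.code

/-- The next entry of the enumeration of the derivable equations. -/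
noncomputable def nextCode (l : List ℕ) : ℕ := (candidates l l.length.unpair.2).getD l.length.unpair.1 0

/-- The first `n` entries of the enumeration of the derivable equations. -/
noncomputable def derivedCodes : ℕ → List ℕ
  | 0 => []
  | n + 1 => derivedCodes n ++ [nextCode (derivedCodes n)]

/-! ### Soundness and completeness of the enumeration -/

theorem derivable_getD {l : List ℕ} (hl : ∀ c ∈ l, Derivable (Equation.decode c)) (n : ℕ) :
    Derivable (Equation.decode (l.getD n 0)) := by
  rcases lt_or_ge n l.length with h | h
  · rw [List.getD_eq_getElem _ _ h]
    exact hl _ (List.getElem_mem h)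
  · rw [List.getD_eq_default _ _ h]
    exact .refl (Term.decode 0)

theorem derivable_of_mem_candidates {l : List ℕ} (hl : ∀ c ∈ l, Derivable (Equation.decode c))
    {b c : ℕ} (hc : c ∈ candidates l b) : Derivable (Equation.decode c) := by
  have hz : Derivable (Equation.decode 0) := .refl (Term.decode 0)
  have hget := derivable_getD hl
  simp only [candidates, List.mem_append, List.mem_cons, List.not_mem_nil, or_false,
    List.mem_map] at hc
  rcases hc with (rfl | rfl | hc | rfl | rfl | rfl | rfl | hc) | ⟨e, he, rfl⟩
  · simpa [Equation.decode] using Derivable.refl _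
  · simpa [Equation.decode] using Derivable.symm _ _ (hget b)
  · split_ifs at hc with h
    · subst hc
      have h1 := hget b.unpair.1
      have h2 := hget b.unpair.2
      rw [Equation.decode, h] at h1
      simpa [Equation.decode] using Derivable.trans _ _ _ h1 h2
    · exact hc ▸ hz
  · simpa [Equation.decode] using Derivable.congr_add _ _ _ _ (hget b.unpair.1) (hget b.unpair.2)
  · simpa [Equation.decode] using Derivable.congr_neg _ _ (hget b)
  · simpa [Equation.decode] using Derivable.congr_cyl b.unpair.1 _ _ (hget b.unpair.2)
  · rw [Equation.decode_code]
    exact .subst _ _ (hget b.unpair.2)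
  · split_ifs at hc with h
    · subst hc
      refine .inductive_rule _ _ h.1 ?_
      rw [← Equation.decode_code (Equation.cylVars _ _), ← h.2]
      exact hget b.unpair.2
    · exact hc ▸ hz
  · rw [Equation.decode_code]
    exact derivable_of_mem_axiomInstances he

theorem derivable_of_mem_derivedCodes {n : ℕ} :
    ∀ c ∈ derivedCodes n, Derivable (Equation.decode c) := by
  induction n with
  | zero => simp [derivedCodes]
  | succ n ih =>
    intro c hc
    simp only [derivedCodes, List.mem_append, List.mem_singleton] at hc
    rcases hc with hc | rfl
    · exact ih c hc
    · exact derivable_getD (fun c hc => derivable_of_mem_candidates ih hc) _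

theorem length_derivedCodes (n : ℕ) : (derivedCodes n).length = n := by
  induction n with
  | zero => rfl
  | succ n ih => simp [derivedCodes, ih]

theorem getD_derivedCodes {m n : ℕ} (h : m < n) :
    (derivedCodes n).getD m 0 = nextCode (derivedCodes m) := by
  induction n, h using Nat.le_induction with
  | base =>
    rw [derivedCodes, List.getD_append_right _ _ _ _ (length_derivedCodes m).le]
    simp [length_derivedCodes]
  | succ n hn ih =>
    rw [derivedCodes, List.getD_append _ _ _ _ ((length_derivedCodes n).symm ▸ hn), ih]

/-- Each choice of a rule or axiom t and a parameter b has its own stage, numbered `Nat.pair t b`.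
-/
theorem nextCode_derivedCodes_pair (t b : ℕ) : nextCode (derivedCodes (Nat.pair t b)) =
    (candidates (derivedCodes (Nat.pair t b)) b).getD t 0 := by
  simp [nextCode, length_derivedCodes]

/-- Induction on the derivation: the stages at which the premises appear are packed into the
parameter b. -/
theorem Derivable.exists_nextCode {e : Equation ℕ} (he : Derivable e) :
    ∃ n, nextCode (derivedCodes n) = e.code := by
  -- Rules with premises have positive numbers t, so stage `Nat.pair t b` comes after all stages
  -- recorded in b and the premises are already listed.
  have hlt : ∀ {t b m : ℕ}, 0 < t → m ≤ b → m < Nat.pair t b := fun {t b m} ht hm => by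
    have := Nat.add_le_pair t b
    omega
  have h1 : ∀ {t x y : ℕ}, 0 < t → x < Nat.pair t (Nat.pair x y) := fun ht =>
    hlt ht (Nat.left_le_pair _ _)
  have h2 : ∀ {t x y : ℕ}, 0 < t → y < Nat.pair t (Nat.pair x y) := fun ht =>
    hlt ht (Nat.right_le_pair _ _)
  induction he with
  | ax e he =>
    obtain ⟨i, j, k, hmem⟩ := he.exists_mem_axiomInstances
    obtain ⟨t, ht, rfl⟩ := List.getElem_of_mem hmem
    -- Eight candidates, one for each rule, precede the axioms.
    refine ⟨Nat.pair (8 + t) (Nat.pair i (Nat.pair j k)), ?_⟩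
    rw [nextCode_derivedCodes_pair, candidates, List.getD_append_right _ _ _ _ (by simp)]
    simp [List.getD, List.getElem?_eq_getElem ht]
  | refl t =>
    refine ⟨Nat.pair 0 t.code, ?_⟩
    rw [nextCode_derivedCodes_pair]
    simp [candidates, Equation.code]
  | symm s t _ ih =>
    obtain ⟨n, hn⟩ := ih
    refine ⟨Nat.pair 1 n, ?_⟩
    rw [nextCode_derivedCodes_pair, candidates, getD_derivedCodes (hlt one_pos le_rfl), hn]
    simp [Equation.code]
  | trans r s t _ _ ih ih' =>
    obtain ⟨m, hm⟩ := ih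
    obtain ⟨n, hn⟩ := ih'
    refine ⟨Nat.pair 2 (Nat.pair m n), ?_⟩
    rw [nextCode_derivedCodes_pair, candidates]
    simp only [Nat.unpair_pair]
    rw [getD_derivedCodes (h1 two_pos), getD_derivedCodes (h2 two_pos), hm, hn]
    simp [Equation.code]
  | congr_add s s' t t' _ _ ih ih' =>
    obtain ⟨m, hm⟩ := ih
    obtain ⟨n, hn⟩ := ih'
    refine ⟨Nat.pair 3 (Nat.pair m n), ?_⟩
    rw [nextCode_derivedCodes_pair, candidates]
    simp only [Nat.unpair_pair]
    rw [getD_derivedCodes (h1 three_pos), getD_derivedCodes (h2 three_pos), hm, hn]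
    simp [Equation.code, Term.code]
  | congr_neg t t' _ ih =>
    obtain ⟨n, hn⟩ := ih
    refine ⟨Nat.pair 4 n, ?_⟩
    rw [nextCode_derivedCodes_pair, candidates, getD_derivedCodes (hlt four_pos le_rfl), hn]
    simp [Equation.code, Term.code]
  | congr_cyl i t t' _ ih =>
    obtain ⟨n, hn⟩ := ih
    refine ⟨Nat.pair 5 (Nat.pair i n), ?_⟩
    rw [nextCode_derivedCodes_pair, candidates]
    simp only [Nat.unpair_pair]
    rw [getD_derivedCodes (h2 (by norm_num)), hn]
    simp [Equation.code, Term.code]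
  | subst σ e _ ih =>
    obtain ⟨n, hn⟩ := ih
    obtain ⟨N, hN⟩ := e.lhs.exists_subst_congr
    obtain ⟨N', hN'⟩ := e.rhs.exists_subst_congr
    let l := (List.range (N + N')).map fun n => (σ n).code
    have hl : ∀ n < N + N', Term.decode (l.getD n 0) = σ n := fun n hn => by
      simp [l, List.getD, List.getElem?_range hn]
    refine ⟨Nat.pair 6 (Nat.pair (Encodable.encode l) n), ?_⟩
    rw [nextCode_derivedCodes_pair, candidates]
    simp only [Nat.unpair_pair]
    rw [getD_derivedCodes (h2 (by norm_num)), hn, Equation.decode_code, Denumerable.ofNat_encode]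
    have : e.subst (fun n => Term.decode (l.getD n 0)) = e.subst σ := by
      rw [Equation.subst, Equation.subst, hN _ _ fun n hn => hl n (by omega),
        hN' _ _ fun n hn => hl n (by omega)]
    change (e.subst fun n => Term.decode (l.getD n 0)).code = (e.subst σ).code
    rw [this]
  | inductive_rule e i hi _ ih =>
    obtain ⟨n, hn⟩ := ih
    refine ⟨Nat.pair 7 (Nat.pair (Nat.pair i e.code) n), ?_⟩
    have hg := getD_derivedCodes (h2 (t := 7) (x := Nat.pair i e.code) (y := n) (by norm_num))
    rw [hn, List.getD_eq_getElem?_getD] at hg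
    rw [nextCode_derivedCodes_pair]
    simp [candidates, hg, hi]

/-! ### Primitive recursiveness of the enumeration -/

section Primrec

variable {P : Type*} [Primcodable P]

theorem primrec_code_mul {s t : P → Term ℕ} (hs : Primrec fun p => (s p).code)
    (ht : Primrec fun p => (t p).code) : Primrec fun p => ((s p).mul (t p)).code := by
  have hneg : Primrec fun n => Nat.pair 2 n := Primrec₂.natPair.comp (Primrec.const 2) Primrec.id
  exact hneg.comp (Primrec₂.natPair.comp (Primrec.const 1)
    (Primrec₂.natPair.comp (hneg.comp hs) (hneg.comp ht)))

theorem primrec_code_add {s t : P → Term ℕ} (hs : Primrec fun p => (s p).code)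
    (ht : Primrec fun p => (t p).code) : Primrec fun p => (Term.add (s p) (t p)).code :=
  Primrec₂.natPair.comp (Primrec.const 1) (Primrec₂.natPair.comp hs ht)

theorem primrec_code_cyl {f : P → ℕ} {t : P → Term ℕ} (hf : Primrec f)
    (ht : Primrec fun p => (t p).code) : Primrec fun p => (Term.cyl (f p) (t p)).code :=
  Primrec₂.natPair.comp (Primrec.const 3) (Primrec₂.natPair.comp hf ht)

theorem primrec_code_diag {f g : P → ℕ} (hf : Primrec f) (hg : Primrec g) :
    Primrec fun p => (Term.diag (f p) (g p)).code :=
  Primrec₂.natPair.comp (Primrec.const 4) (Primrec₂.natPair.comp hf hg)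

theorem primrec_code_equation {s t : P → Term ℕ} (hs : Primrec fun p => (s p).code)
    (ht : Primrec fun p => (t p).code) : Primrec fun p => (Equation.mk (s p) (t p)).code :=
  Primrec₂.natPair.comp hs ht

theorem primrec_code_ite {c : P → Prop} [DecidablePred c] (hc : PrimrecPred c)
    {e e' : P → Equation ℕ} (he : Primrec fun p => (e p).code)
    (he' : Primrec fun p => (e' p).code) :
    Primrec fun p => (if c p then e p else e' p).code :=
  (Primrec.ite hc he he').of_eq fun p => by split_ifs <;> rfl

theorem primrec_axiomInstances {f g h : P → ℕ} (hf : Primrec f) (hg : Primrec g)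
    (hh : Primrec h) :
    Primrec fun p => (axiomInstances (f p) (g p) (h p)).map Equation.code := by
  have hconst : ∀ t : Term ℕ, Primrec fun _ : P => t.code := fun t => Primrec.const _
  have hc : ∀ {t : P → Term ℕ}, (Primrec fun p => (t p).code) →
    Primrec fun p => (Term.cyl (f p) (t p)).code := fun ht => primrec_code_cyl hf ht
  simp only [axiomInstances, List.map_cons, List.map_nil]
  iterate 10 refine Primrec.list_cons.comp (Primrec.const _) ?_
  refine Primrec.list_cons.comp (primrec_code_equation (hc (hconst _)) (hconst _)) ?_
  refine Primrec.list_cons.comp (primrec_code_equation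
    (primrec_code_add (hconst _) (hc (hconst _))) (hc (hconst _))) ?_
  refine Primrec.list_cons.comp (primrec_code_equation
    (hc (primrec_code_mul (hconst _) (hc (hconst _))))
    (primrec_code_mul (hc (hconst _)) (hc (hconst _)))) ?_
  refine Primrec.list_cons.comp (primrec_code_equation
    (hc (primrec_code_cyl hg (hconst _))) (primrec_code_cyl hg (hc (hconst _)))) ?_
  refine Primrec.list_cons.comp (primrec_code_equation
    (primrec_code_diag hf hf) (hconst _)) ?_
  refine Primrec.list_cons.comp (primrec_code_ite
    ((Primrec.eq.comp hh hf).or (Primrec.eq.comp hh hg)) (Primrec.const _)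
    (primrec_code_equation (primrec_code_diag hf hg) (primrec_code_cyl hh
      (primrec_code_mul (primrec_code_diag hf hh) (primrec_code_diag hh hg))))) ?_
  exact Primrec.list_cons.comp (primrec_code_ite (Primrec.eq.comp hf hg) (Primrec.const _)
    (primrec_code_equation (primrec_code_mul
      (hc (primrec_code_mul (primrec_code_diag hf hg) (hconst _)))
      (hc (primrec_code_mul (primrec_code_diag hf hg) (hconst _)))) (hconst _))) (Primrec.const _)

theorem primrec_code_subst_equation {Q : Type*} [Primcodable Q] {σ : Q → ℕ → Term ℕ}
    (hσ : Primrec₂ fun q n => (σ q n).code) {f : P → Q} {g : P → ℕ} (hf : Primrec f)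
    (hg : Primrec g) : Primrec fun p => ((Equation.decode (g p)).subst (σ (f p))).code := by
  have h := Term.primrec_code_subst_decode hσ
  have hu := Primrec.unpair.comp hg
  exact Primrec₂.natPair.comp (h.comp hf (Primrec.fst.comp hu)) (h.comp hf (Primrec.snd.comp hu))

theorem primrec_candidates : Primrec₂ candidates := by
  classical
  have hx : Primrec fun q : List ℕ × ℕ => q.2.unpair.1 :=
    Primrec.fst.comp (Primrec.unpair.comp Primrec.snd)
  have hy : Primrec fun q : List ℕ × ℕ => q.2.unpair.2 :=
    Primrec.snd.comp (Primrec.unpair.comp Primrec.snd)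
  have hget : ∀ {f : List ℕ × ℕ → ℕ}, Primrec f →
      Primrec fun q : List ℕ × ℕ => q.1.getD (f q) 0 :=
    fun hf => (Primrec.list_getD 0).comp Primrec.fst hf
  have hfst : ∀ {f : List ℕ × ℕ → ℕ}, Primrec f → Primrec fun q => (f q).unpair.1 :=
    fun hf => Primrec.fst.comp (Primrec.unpair.comp hf)
  have hsnd : ∀ {f : List ℕ × ℕ → ℕ}, Primrec f → Primrec fun q => (f q).unpair.2 :=
    fun hf => Primrec.snd.comp (Primrec.unpair.comp hf)
  have hpair : ∀ {f g : List ℕ × ℕ → ℕ}, Primrec f → Primrec g →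
    Primrec fun q => Nat.pair (f q) (g q) := fun hf hg => Primrec₂.natPair.comp hf hg
  have hc : ∀ k : ℕ, Primrec fun _ : List ℕ × ℕ => k := fun k => Primrec.const k
  have hb := hget Primrec.snd
  have hbx := hget hx
  have hby := hget hy
  refine Primrec.list_append.comp ?_ (primrec_axiomInstances hx (hfst hy) (hsnd hy))
  refine Primrec.list_cons.comp (hpair Primrec.snd Primrec.snd) ?_
  refine Primrec.list_cons.comp (hpair (hsnd hb) (hfst hb)) ?_
  refine Primrec.list_cons.comp (Primrec.ite (Primrec.eq.comp (hsnd hbx) (hfst hby))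
    (hpair (hfst hbx) (hsnd hby)) (hc 0)) ?_
  refine Primrec.list_cons.comp (hpair (hpair (hc 1) (hpair (hfst hbx) (hfst hby)))
    (hpair (hc 1) (hpair (hsnd hbx) (hsnd hby)))) ?_
  refine Primrec.list_cons.comp (hpair (hpair (hc 2) (hfst hb)) (hpair (hc 2) (hsnd hb))) ?_
  refine Primrec.list_cons.comp (hpair (hpair (hc 3) (hpair hx (hfst hby)))
    (hpair (hc 3) (hpair hx (hsnd hby)))) ?_
  refine Primrec.list_cons.comp (primrec_code_subst_equation
    (σ := fun (l : List ℕ) n => Term.decode (l.getD n 0))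
    (Term.primrec_code_decode.comp (Primrec.list_getD 0))
    ((Primrec.ofNat (List ℕ)).comp hx) hby) ?_
  refine Primrec.list_cons.comp (Primrec.ite (PrimrecPred.and (PrimrecPred.not ?_)
    (Primrec.eq.comp hby (primrec_code_subst_equation (σ := fun (i : ℕ) n => .cyl i (.var n))
      (primrec_code_cyl Primrec.fst (Primrec₂.natPair.comp (Primrec.const 0) Primrec.snd))
      (hfst hx) (hsnd hx)))) (hsnd hx) (hc 0)) (Primrec.const [])
  · exact PrimrecPred.or (Term.primrecRel_mem_ind_decode.comp (hfst hx) (hfst (hsnd hx)))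
      (Term.primrecRel_mem_ind_decode.comp (hfst hx) (hsnd (hsnd hx)))

theorem primrec_derivedCodes : Primrec derivedCodes := by
  have hlen : Primrec fun l : List ℕ => l.length.unpair :=
    Primrec.unpair.comp Primrec.list_length
  have hnext : Primrec nextCode := (Primrec.list_getD 0).comp
    (primrec_candidates.comp Primrec.id (Primrec.snd.comp hlen)) (Primrec.fst.comp hlen)
  refine (Primrec.nat_rec₁ (f := fun _ l => l ++ [nextCode l]) []
    (Primrec.list_append.comp Primrec.snd (Primrec.list_cons.comp (hnext.comp Primrec.snd)
      (Primrec.const [])))).of_eq fun n => ?_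
  induction n with
  | zero => rfl
  | succ n ih => rw [derivedCodes, ← ih]

end Primrec

theorem rePred_exists_nat {R : ℕ → ℕ → Prop} (hR : PrimrecRel R) :
    REPred fun n => ∃ k, R n k := by
  classical
  have h : Partrec₂ fun n k => (Part.some (decide (R n k)) : Part Bool) :=
    hR.decide.to_comp.partrec₂
  refine (Partrec.rfind h).dom_re.of_eq fun n => ?_
  constructor
  · intro h
    obtain ⟨k, hk, -⟩ := Nat.rfind_dom.1 h
    exact ⟨k, by simpa using hk⟩
  · rintro ⟨k, hk⟩
    exact Nat.rfind_dom.2 ⟨k, by simpa using hk, fun _ => trivial⟩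

theorem rePred_derivable : REPred fun n => ∃ e : Equation ℕ, e.code = n ∧ Derivable e := by
  classical
  have hcode : Primrec fun n => (Equation.decode n).code :=
    Primrec₂.natPair.comp (Term.primrec_code_decode.comp (Primrec.fst.comp Primrec.unpair))
      (Term.primrec_code_decode.comp (Primrec.snd.comp Primrec.unpair))
  -- Decoding is total and not injective, so an entry of the enumeration may fail to be a genuine
  -- Gödel number; the second conjunct excludes such entries.
  have hR : PrimrecRel fun n k : ℕ =>
      (derivedCodes (k + 1)).getD k 0 = n ∧ (Equation.decode n).code = n :=
    PrimrecPred.and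
      (Primrec.eq.comp ((Primrec.list_getD 0).comp
        (primrec_derivedCodes.comp (Primrec.succ.comp Primrec.snd)) Primrec.snd) Primrec.fst)
      (Primrec.eq.comp (hcode.comp Primrec.fst) Primrec.fst)
  refine (rePred_exists_nat hR).of_eq fun n => ⟨?_, ?_⟩
  · rintro ⟨k, hk, hn⟩
    exact ⟨Equation.decode n, hn, hk ▸ derivable_getD derivable_of_mem_derivedCodes k⟩
  · rintro ⟨e, rfl, he⟩
    obtain ⟨k, hk⟩ := he.exists_nextCode
    exact ⟨k, (getD_derivedCodes k.lt_succ_self).trans hk, by rw [Equation.decode_code]⟩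

end CylAlg

theorem corollary4p11 (α : Type*) [Infinite α] :
    IsLeast
      {E : Set (CylAlg.Equation α) |
        (∀ e, CylAlg.CAAxiom e → e ∈ E) ∧
        CylAlg.ClosedUnderEquationalLogic E ∧
        CylAlg.ClosedUnderInductiveRule E}
      (CylAlg.eqTheory (CylAlg.RCA α)) ∧
    ∀ ρ : ℕ → α, Function.Injective ρ →
      REPred fun n : ℕ => ∃ e : CylAlg.Equation ℕ,
        e.code = n ∧ e.rename ρ ∈ CylAlg.eqTheory (CylAlg.RCA α) := by
  have h := CylAlg.isInductiveTheory_eqTheory_RCA α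
  refine ⟨⟨⟨h.ax, h.logic, h.inductive_rule⟩, fun E hE => ?_⟩, fun ρ hρ => ?_⟩
  · exact CylAlg.IsInductiveTheory.eqTheory_RCA_subset ⟨hE.1, hE.2.1, hE.2.2⟩
  · simpa only [CylAlg.derivable_iff_rename_mem hρ] using CylAlg.rePred_derivable
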